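/- Let $Q$ be an embedded submanifold of a Euclidean space, $\nabla$ an affine connection on $Q$, $Y_0,Y_1,\dots,Y_n$ smooth vector fields on $Q$, $R$ a smooth bundle map over $Q$ (a linear map $R(q):T_qQ\to T_qQ$ for each $q$), and $\psi:Q\to\mathbb R$ a smooth function. Let $\alpha:\mathbb R\to\mathbb R$ be smooth such that $\alpha\alpha'$ is positive and strictly increasing. Let $u:\mathbb R\to\mathbb R^n$ be measurable, bounded, $T$-periodic ($T>0$) and zero-mean, such that its zero-mean antiderivative $U$ satisfies $\frac1T\int_0^T U^i(\tau)U^j(\tau)\,d\tau=\delta_{ij}$ for all $i,j$. Let $\lambda,\mu\in\mathbb R^n$ and $h>0$. Write $\langle X:Y\rangle=\nabla_YX+\nabla_XY$ for the symmetric product and $X\psi$ for the Lie derivative. Apply to the control system $\nabla_{\dot q}\dot q=Y_0(q)-R(q)\dot q+\sum_{i=1}^n \mathrm u^iY_i(q)$ with output $\mathrm y=\psi(q)$ the feedback law $$\mathrm u^i=\omega\,u^i(\omega t)\,\lambda^i\alpha(\mathrm y-\eta)+\mu^i(\lambda^i)^2\alpha^2(\mathrm y-\eta),\qquad \dot\eta=-h\eta+h\mathrm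 y,$$ with parameter $\omega>0$. This gives the closed-loop system $$\nabla_{\dot q}\dot q=Y_0(q)-R(q)\dot q+\sum_{i=1}^n\mu^i(\lambda^i)^2\alpha^2(\psi(q)-\eta)Y_i(q)+\sum_{i=1}^n\omega\,u^i(\omega t)\lambda^i\alpha(\psi(q)-\eta)Y_i(q),\qquad \dot\eta=-h\eta+h\psi(q).\tag{1}$$ Consider also the averaged system $$\begin{aligned}\nabla_{\dot{\bar q}}\dot{\bar q}={}&Y_0(\bar q)-R(\bar q)\dot{\bar q}+\alpha^2(\psi(\bar q)-\bar\eta)\sum_{i=1}^n(\lambda^i)^2\mu^iY_i(\bar q)-\tfrac12\alpha^2(\psi(\bar q)-\bar\eta)\sum_{i=1}^n(\lambda^i)^2\langle Y_i:Y_i\rangle(\bar q)\\&-(\alpha\alpha')(\psi(\bar q)-\bar\eta)\sum_{i=1}^n(\lambda^i)^2(Y_i\psi)(\bar q)\,Y_i(\bar q),\qquad \dot{\bar\eta}=-h\bar\eta+h\psi(\bar q).\end{aligned}\tag{2}$$ Both are regarded as first-order systems on $M=TQ\times\mathbb R$ with state $x=(q,v,\eta)$, $v=\dot q$, with solutions in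 the sense of Carathéodory; $|\cdot|$ is the Euclidean norm of the ambient space of $M$. For $\omega>0$ and $t\in\mathbb R$ let $\phi^\omega_t:M\to M$ be the bijection $$\phi^\omega_t(q,v,\eta)=\Big(q,\;v-\sum_{i=1}^nU^i(\omega t)\,\lambda^i\alpha(\psi(q)-\eta)\,Y_i(q),\;\eta\Big).$$ Then every initial value problem for (1) (for every $\omega>0$) and for (2) has a unique maximal solution, and the solutions of (1) in the variables $\tilde x=\phi^\omega_t(x)$ approximate the solutions of (2) in the following sense: for every compact $C\subseteq M$ and all $\nu,\Delta>0$ there exists $\omega_0>0$ such that, for every $t_0\in\mathbb R$ and every $\bar x_0\in C$, if the maximal solution $\bar x$ of (2) with $\bar x(t_0)=\bar x_0$ exists on $[t_0,t_0+\Delta]$ and satisfies $\bar x(t)\in C$ there, then for every $\omega\ge\omega_0$ the maximal solution $x$ of (1) with $x(t_0)=(\phi^\omega_{t_0})^{-1}(\bar x_0)$ exists on $[t_0,t_0+\Delta]$ and satisfies $|\phi^\omega_t(x(t))-\bar x(t)|\le\nu$ for every $t\in[t_0,t_0+\Delta]$. -/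

import Mathlib

open Set MeasureTheory Topology

noncomputable section

namespace ESC

/-! ## Submanifolds of Euclidean space, vector fields, affine connections -/

/-- The Euclidean space `ℝ^N`. -/
abbrev Euc (N : ℕ) : Type := EuclideanSpace ℝ (Fin N)

/-- `Q ⊆ ℝ^N` is an embedded (smooth) submanifold: around each of its points there is a smooth
diffeomorphism between open subsets of `ℝ^N` that straightens `Q` to a linear subspace. (The
dimension of that subspace is locally constant on `Q`.) -/
def IsEmbeddedSubmanifold {N : ℕ} (Q : Set (Euc N)) : Prop :=
  ∀ q ∈ Q, ∃ (Φ : OpenPartialHomeomorph (Euc N) (Euc N)) (V : Submodule ℝ (Euc N)),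
    q ∈ Φ.source ∧ ContDiffOn ℝ (⊤ : ℕ∞) Φ Φ.source ∧ ContDiffOn ℝ (⊤ : ℕ∞) Φ.symm Φ.target ∧
      ∀ p ∈ Φ.source, (p ∈ Q ↔ Φ p ∈ V)

/-- A map on a subset `S` of a normed space is smooth (`C^∞`) if, locally around every point of
`S`, it is the restriction of a smooth map defined on an open subset of the ambient space. -/
def IsSmooth {A B : Type*} [NormedAddCommGroup A] [NormedSpace ℝ A] [NormedAddCommGroup B]
    [NormedSpace ℝ B] {S : Set A} (f : S → B) : Prop :=
  ∀ p : S, ∃ U : Set A, IsOpen U ∧ (p : A) ∈ U ∧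
    ∃ g : A → B, ContDiffOn ℝ (⊤ : ℕ∞) g U ∧ ∀ y : S, (y : A) ∈ U → f y = g y

/-- The tangent space `T_q Q` as a subspace of `ℝ^N`: the velocities at `q` of curves in `Q`
(for an embedded submanifold these already form a linear subspace). -/
def tangentSpace {N : ℕ} (Q : Set (Euc N)) (q : Euc N) : Submodule ℝ (Euc N) :=
  Submodule.span ℝ {v | ∃ γ : ℝ → Euc N,
    γ 0 = q ∧ (∀ᶠ t in 𝓝 (0 : ℝ), γ t ∈ Q) ∧ HasDerivAt γ v 0}

/-- The tangent bundle `TQ`, as a subset of `ℝ^N × ℝ^N`. -/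
def tangentBundle {N : ℕ} (Q : Set (Euc N)) : Set (Euc N × Euc N) :=
  {p | p.1 ∈ Q ∧ p.2 ∈ tangentSpace Q p.1}

/-- The derivative at `q ∈ Q` of a map on `Q` in the direction `v`. For a smooth map and a tangent
vector `v` at `q` this does not depend on the extension of the map off `Q`. -/
def dirDeriv {N : ℕ} {Q : Set (Euc N)} {B : Type*} [NormedAddCommGroup B] [NormedSpace ℝ B]
    (f : Q → B) (q : Q) (v : Euc N) : B :=
  fderivWithin ℝ (Function.extend Subtype.val f 0) Q q v

/-- Smooth real-valued functions on `Q`. -/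
structure SmoothFunction {N : ℕ} (Q : Set (Euc N)) where
  toFun : Q → ℝ
  smooth : IsSmooth toFun

instance {N : ℕ} {Q : Set (Euc N)} : CoeFun (SmoothFunction Q) (fun _ => Q → ℝ) :=
  ⟨SmoothFunction.toFun⟩

/-- Smooth vector fields on `Q`. -/
structure VectorField {N : ℕ} (Q : Set (Euc N)) where
  toFun : Q → Euc N
  tangent : ∀ q : Q, toFun q ∈ tangentSpace Q q
  smooth : IsSmooth toFun

instance {N : ℕ} {Q : Set (Euc N)} : CoeFun (VectorField Q) (fun _ => Q → Euc N) :=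
  ⟨VectorField.toFun⟩

/-- Pointwise sum of vector fields. -/
instance {N : ℕ} {Q : Set (Euc N)} : Add (VectorField Q) where
  add X Y :=
    { toFun := fun q => X q + Y q
      tangent := fun q => add_mem (X.tangent q) (Y.tangent q)
      smooth := fun p => by
        obtain ⟨U, hU, hp, g, hg, h⟩ := X.smooth p
        obtain ⟨U', hU', hp', g', hg', h'⟩ := Y.smooth p
        exact ⟨U ∩ U', hU.inter hU', ⟨hp, hp'⟩, fun y => g y + g' y,
          (hg.mono inter_subset_left).add (hg'.mono inter_subset_right),
          fun y hy => by simp only [h y hy.1, h' y hy.2]⟩ }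

/-- Pointwise product of a smooth function and a vector field. -/
instance {N : ℕ} {Q : Set (Euc N)} : SMul (SmoothFunction Q) (VectorField Q) where
  smul f Y :=
    { toFun := fun q => f q • Y q
      tangent := fun q => Submodule.smul_mem _ _ (Y.tangent q)
      smooth := fun p => by
        obtain ⟨U, hU, hp, g, hg, h⟩ := f.smooth p
        obtain ⟨U', hU', hp', g', hg', h'⟩ := Y.smooth p
        exact ⟨U ∩ U', hU.inter hU', ⟨hp, hp'⟩, fun y => g y • g' y,
          (hg.mono inter_subset_left).smul (hg'.mono inter_subset_right),
          fun y hy => by simp only [h y hy.1, h' y hy.2]⟩ }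

/-- The Lie derivative `Xψ` of a function along a vector field. -/
def lieDeriv {N : ℕ} {Q : Set (Euc N)} (X : VectorField Q) (f : SmoothFunction Q) (q : Q) : ℝ :=
  dirDeriv f q (X q)

/-- An affine connection on `Q`; `cov X Y` is `∇_X Y`. Homogeneity with respect to real scalars is
contained in the last two laws (constant functions). -/
structure AffineConnection {N : ℕ} (Q : Set (Euc N)) where
  cov : VectorField Q → VectorField Q → VectorField Q
  add_left : ∀ X X' Y, cov (X + X') Y = cov X Y + cov X' Y
  add_right : ∀ X Y Y', cov X (Y + Y') = cov X Y + cov X Y'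
  smul_left : ∀ (f : SmoothFunction Q) X Y, cov (f • X) Y = f • cov X Y
  leibniz : ∀ (f : SmoothFunction Q) X Y (q : Q),
    cov X (f • Y) q = f q • cov X Y q + lieDeriv X f q • Y q

/-- The symmetric product `⟨X : Y⟩ = ∇_Y X + ∇_X Y`. -/
def AffineConnection.symProd {N : ℕ} {Q : Set (Euc N)} (conn : AffineConnection Q)
    (X Y : VectorField Q) : VectorField Q :=
  conn.cov Y X + conn.cov X Y

open Classical in
/-- The acceleration part of the geodesic spray of the connection: `D_v Y (q) - (∇_Y Y)(q)`, where
`Y` is any smooth vector field with `Y(q) = v` (the value does not depend on `Y`). -/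
def AffineConnection.spray {N : ℕ} {Q : Set (Euc N)} (conn : AffineConnection Q)
    (q : Q) (v : Euc N) : Euc N :=
  if h : ∃ Y : VectorField Q, Y q = v then
    dirDeriv h.choose q v - conn.cov h.choose h.choose q
  else 0

/-- The geometric acceleration `∇_q̇ q̇` of a curve in `Q` at an instant at which it has position
`q`, velocity `v` and ordinary (ambient) second derivative `a`.

If `Y` is a vector field with `Y(q) = v`, then `q̇ = Y ∘ q + (q̇ - Y ∘ q)` along the curve. The
covariant derivative along the curve of the first summand is `∇_q̇ Y = (∇_Y Y)(q)`; the second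
summand vanishes at the given instant, so that, by the Leibniz rule, its covariant derivative is
its ordinary derivative `a - D_v Y (q)`. -/
def AffineConnection.geometricAcceleration {N : ℕ} {Q : Set (Euc N)} (conn : AffineConnection Q)
    (q : Q) (v a : Euc N) : Euc N :=
  a - conn.spray q v

/-- `∇_q̇ q̇ = w` means `q̈ = spray(q, q̇) + w`. -/
theorem AffineConnection.geometricAcceleration_eq_iff {N : ℕ} {Q : Set (Euc N)}
    (conn : AffineConnection Q) (q : Q) (v a w : Euc N) :
    conn.geometricAcceleration q v a = w ↔ a = conn.spray q v + w := by
  unfold AffineConnection.geometricAcceleration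
  rw [sub_eq_iff_eq_add, add_comm]

/-- A smooth bundle map over `Q`: a linear endomorphism of every tangent space, smooth as a map on
the tangent bundle. -/
structure BundleMap {N : ℕ} (Q : Set (Euc N)) where
  toFun : (q : Q) → tangentSpace Q q →ₗ[ℝ] tangentSpace Q q
  smooth : IsSmooth (S := tangentBundle Q)
    (fun p => (toFun ⟨p.1.1, p.2.1⟩ ⟨p.1.2, p.2.2⟩ : Euc N))

/-! ## Solutions of differential equations, and approximation of solutions -/

section ODE

variable {F : Type*} [NormedAddCommGroup F] [NormedSpace ℝ F] {M : Set F}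

/-- `x` is a (Carathéodory) solution of `ẋ = f(t,x)` in `M` on the interval `I`. -/
def IsSolutionOn (f : ℝ → M → F) (I : Set ℝ) (x : ℝ → M) : Prop :=
  I.OrdConnected ∧ ∀ s ∈ I, ∀ t ∈ I,
    IntervalIntegrable (fun τ => f τ (x τ)) volume s t ∧
      (x t : F) = x s + ∫ τ in s..t, f τ (x τ)

/-- `x`, with interval of definition `I`, is a maximal solution of `ẋ = f(t,x)`, `x(t₀) = x₀`. -/
def IsMaximalSolution (f : ℝ → M → F) (t₀ : ℝ) (x₀ : M) (I : Set ℝ) (x : ℝ → M) : Prop :=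
  t₀ ∈ I ∧ x t₀ = x₀ ∧ IsSolutionOn f I x ∧
    ∀ (J : Set ℝ) (y : ℝ → M), IsSolutionOn f J y → I ⊆ J → EqOn y x I → J = I

/-- Every initial value problem for `ẋ = f(t,x)` has a unique maximal solution. -/
def HasUniqueMaximalSolutions (f : ℝ → M → F) : Prop :=
  ∀ (t₀ : ℝ) (x₀ : M), ∃ (I : Set ℝ) (x : ℝ → M), IsMaximalSolution f t₀ x₀ I x ∧
    ∀ (J : Set ℝ) (y : ℝ → M), IsMaximalSolution f t₀ x₀ J y → J = I ∧ EqOn y x I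

/-- The solutions of `ẋ = f^ω(t,x)` in the variables `x̃ = φ^ω_t(x)` approximate the solutions of
`dx̄/dt = f̄(t,x̄)`. -/
def Approximates (f : ℝ → ℝ → M → F) (φ : ℝ → ℝ → M ≃ M) (fbar : ℝ → M → F) : Prop :=
  ∀ C : Set M, IsCompact C → ∀ ν > 0, ∀ Δ > 0, ∃ ω₀ > 0, ∀ t₀ : ℝ, ∀ x₀ ∈ C,
    ∀ (J : Set ℝ) (xbar : ℝ → M), IsMaximalSolution fbar t₀ x₀ J xbar →
      (∀ t ∈ Icc t₀ (t₀ + Δ), t ∈ J ∧ xbar t ∈ C) →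
      ∀ ω ≥ ω₀, ∀ (I : Set ℝ) (x : ℝ → M),
        IsMaximalSolution (f ω) t₀ ((φ ω t₀).symm x₀) I x →
        ∀ t ∈ Icc t₀ (t₀ + Δ), t ∈ I ∧ ‖(φ ω t (x t) : F) - (xbar t : F)‖ ≤ ν

end ODE

/-! ## The state space `TQ × ℝ` -/

/-- `ℝ^N × ℝ^N × ℝ` with the Euclidean norm. -/
abbrev Ambient (N : ℕ) : Type := WithLp 2 (Euc N × WithLp 2 (Euc N × ℝ))

/-- The point `(q, v, η)` of `ℝ^N × ℝ^N × ℝ`. -/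
def mk {N : ℕ} (q v : Euc N) (η : ℝ) : Ambient N := WithLp.toLp 2 (q, WithLp.toLp 2 (v, η))

/-- `M = TQ × ℝ`, as a subset of Euclidean space. -/
def stateSpace {N : ℕ} (Q : Set (Euc N)) : Set (Ambient N) :=
  {x | x.fst ∈ Q ∧ x.snd.fst ∈ tangentSpace Q x.fst}

/-- The configuration `q` of a state. -/
def pos {N : ℕ} {Q : Set (Euc N)} (x : stateSpace Q) : Q := ⟨x.1.fst, x.2.1⟩

/-- The velocity `v` of a state. -/
def vel {N : ℕ} {Q : Set (Euc N)} (x : stateSpace Q) : tangentSpace Q (pos x) :=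
  ⟨x.1.snd.fst, x.2.2⟩

/-- The filter state `η` of a state. -/
def filt {N : ℕ} {Q : Set (Euc N)} (x : stateSpace Q) : ℝ := x.1.snd.snd

/-- Shift of the velocity by a tangent vector, `(q, v, η) ↦ (q, v + w, η)`. -/
def shiftVel {N : ℕ} {Q : Set (Euc N)} (x : stateSpace Q) (w : tangentSpace Q (pos x)) :
    stateSpace Q :=
  ⟨mk (pos x) ((vel x : Euc N) + w) (filt x), x.2.1, add_mem x.2.2 w.2⟩

/-- The first-order system on `TQ × ℝ` of the second-order system
`∇_q̇ q̇ = W`, `η̇ = -hη + hψ(q)`. -/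
def firstOrderField {N : ℕ} {Q : Set (Euc N)} (conn : AffineConnection Q)
    (ψ : SmoothFunction Q) (h : ℝ) (W : stateSpace Q → Euc N) (x : stateSpace Q) : Ambient N :=
  mk (vel x) (conn.spray (pos x) (vel x) + W x) (-h * filt x + h * ψ (pos x))

/-! ## Dither signals, closed-loop system, change of variables, averaged system -/

/-- The zero-mean antiderivative (in each component) of the `T`-periodic map `u`. -/
def zeroMeanPrimitive {n : ℕ} (u : ℝ → Fin n → ℝ) (T : ℝ) (τ : ℝ) (i : Fin n) : ℝ :=
  (∫ s in (0 : ℝ)..τ, u s i) - (1 / T) * ∫ r in (0 : ℝ)..T, ∫ s in (0 : ℝ)..r, u s i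

/-- Admissible dither signals `u` with period `T`: measurable, bounded, `T`-periodic, zero-mean, and
with `L²`-orthonormal zero-mean antiderivatives. -/
structure IsDither {n : ℕ} (u : ℝ → Fin n → ℝ) (T : ℝ) : Prop where
  period_pos : 0 < T
  measurable : Measurable u
  bounded : ∃ B : ℝ, ∀ τ i, |u τ i| ≤ B
  periodic : Function.Periodic u T
  zeroMean : ∀ i, ∫ τ in (0 : ℝ)..T, u τ i = 0
  orthonormal : ∀ i j, (1 / T) * ∫ τ in (0 : ℝ)..T,
    zeroMeanPrimitive u T τ i * zeroMeanPrimitive u T τ j = if i = j then 1 else 0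

/-- The output-feedback law
`u^i = ω u^i(ωt) λ^i α(y - η) + μ^i (λ^i)² α²(y - η)`. -/
def feedback {n : ℕ} (α : ℝ → ℝ) (u : ℝ → Fin n → ℝ) (lam mu : Fin n → ℝ)
    (ω t y η : ℝ) (i : Fin n) : ℝ :=
  ω * u (ω * t) i * lam i * α (y - η) + mu i * lam i ^ 2 * α (y - η) ^ 2

/-- The closed-loop system: `∇_q̇ q̇ = Y₀ - R q̇ + ∑ u^i Y_i` with the output-feedback law and the
high-pass filter. -/
def closedLoopField {N n : ℕ} {Q : Set (Euc N)} (conn : AffineConnection Q)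
    (Y₀ : VectorField Q) (Y : Fin n → VectorField Q) (R : BundleMap Q) (ψ : SmoothFunction Q)
    (α : ℝ → ℝ) (u : ℝ → Fin n → ℝ) (lam mu : Fin n → ℝ) (h : ℝ)
    (ω t : ℝ) : stateSpace Q → Ambient N :=
  firstOrderField conn ψ h fun x =>
    Y₀ (pos x) - R.toFun (pos x) (vel x)
      + ∑ i, feedback α u lam mu ω t (ψ (pos x)) (filt x) i • Y i (pos x)

/-- The vector `∑ U^i(τ) λ^i α(ψ(q) - η) Y_i(q)`. -/
def ditherShift {N n : ℕ} {Q : Set (Euc N)} (Y : Fin n → VectorField Q) (ψ : SmoothFunction Q)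
    (α : ℝ → ℝ) (U : ℝ → Fin n → ℝ) (lam : Fin n → ℝ) (τ : ℝ) (q : Q) (η : ℝ) :
    tangentSpace Q q :=
  ∑ i, (U τ i * lam i * α (ψ q - η)) • (⟨Y i q, (Y i).tangent q⟩ : tangentSpace Q q)

/-- The change of variables
`q̃ = q`, `η̃ = η`, `ṽ = v - ∑ U^i(ωt) λ^i α(ψ(q) - η) Y_i(q)` on `TQ × ℝ`. -/
def changeOfVariables {N n : ℕ} {Q : Set (Euc N)} (Y : Fin n → VectorField Q)
    (ψ : SmoothFunction Q) (α : ℝ → ℝ) (U : ℝ → Fin n → ℝ) (lam : Fin n → ℝ)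
    (ω t : ℝ) : stateSpace Q ≃ stateSpace Q where
  toFun x := shiftVel x (-ditherShift Y ψ α U lam (ω * t) (pos x) (filt x))
  invFun x := shiftVel x (ditherShift Y ψ α U lam (ω * t) (pos x) (filt x))
  left_inv x := by
    apply Subtype.ext
    change mk (pos x : Euc N) (((vel x : Euc N) + _) + _) (filt x) = _
    exact congrArg (fun v => mk (pos x : Euc N) v (filt x)) (neg_add_cancel_right _ _)
  right_inv x := by
    apply Subtype.ext
    change mk (pos x : Euc N) (((vel x : Euc N) + _) + _) (filt x) = _
    exact congrArg (fun v => mk (pos x : Euc N) v (filt x)) (add_neg_cancel_right _ _)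

/-- The averaged system. -/
def averagedField {N n : ℕ} {Q : Set (Euc N)} (conn : AffineConnection Q)
    (Y₀ : VectorField Q) (Y : Fin n → VectorField Q) (R : BundleMap Q) (ψ : SmoothFunction Q)
    (α : ℝ → ℝ) (lam mu : Fin n → ℝ) (h : ℝ) : stateSpace Q → Ambient N :=
  firstOrderField conn ψ h fun x =>
    Y₀ (pos x) - R.toFun (pos x) (vel x)
      + α (ψ (pos x) - filt x) ^ 2 • ∑ i, (lam i ^ 2 * mu i) • Y i (pos x)
      - ((1 / 2 : ℝ) * α (ψ (pos x) - filt x) ^ 2) •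
          ∑ i, lam i ^ 2 • conn.symProd (Y i) (Y i) (pos x)
      - (α (ψ (pos x) - filt x) * deriv α (ψ (pos x) - filt x)) •
          ∑ i, (lam i ^ 2 * lieDeriv (Y i) ψ (pos x)) • Y i (pos x)

end ESC

end

noncomputable section

namespace ESC

/-! ## Solutions of differential equations -/

section Solutions

variable {F : Type*} [NormedAddCommGroup F] [NormedSpace ℝ F] {M : Set F}
  {f : ℝ → M → F} {I J : Set ℝ} {x y : ℝ → M}

/-! The large term of size `ω` is a time derivative up to bounded terms. Put `s = ∑ U^i(ωt) λ^i
α(ψ(q) - η) Y_i(q)`. Along a solution of the closed loop, `ds/dt` contains exactly the terms `ω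
u^i(ωt) λ^i α Y_i`, so the new velocity `w = v - s` obeys an equation without the factor `ω`. Its
right-hand side is `∑ g_k(ωt) X_k`, where the coefficients `1`, `U^i`, `U^i U^j` are continuous and
periodic and the fields `X_k` are smooth, tangent to `TQ × ℝ` and independent of `ω`
(`closedLoopField_eq`).

The geometry lies in the spray. It is the diagonal of a bilinear map `S` with `S(w, Y(q)) = D_w Y -
∇_w Y`, so the ambient derivatives `D_v Y_i` occurring in `ds/dt` cancel against `S(v, s)` and only
covariant derivatives survive (`spray_add_sum_eq`). The coefficients have means `1`, `0`, `δ_ij`.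
Hence averaging keeps the drift and the diagonal quadratic terms: `-(λ^i)² α² ∇_{Y_i} Y_i`, which is
half a symmetric product, and `-(λ^i)² α α' (Y_i ψ) Y_i`, which comes from differentiating `α` along
the `Y_i`-part of `v` (`averagedField_eq`).

What remains is first-order averaging on a submanifold. Integration by parts bounds the oscillating
integrals by `O(1/ω)`, and Grönwall turns this into an `O(1/ω)` distance as long as both solutions
stay in a fixed compact set. A first-exit argument and a uniform local existence time then give
existence on the whole interval (`exists_forall_norm_sub_le_of_averaging`). Local existence uses
that the state space is locally the fixed set of a smooth retraction: the fields are extended by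
composing with it, the ambient equation is solved, and its solution is shown to remain in the set.

Since `u` is only measurable, solutions are handled as integral equations. The change of variables
is still legitimate because the dither enters only the velocity equation: `q` and `η` are
continuously differentiable along every solution, and `s` involves no other state. -/

theorem IsSolutionOn.mono (h : IsSolutionOn f I x) (hJ : J.OrdConnected) (hJI : J ⊆ I) :
    IsSolutionOn f J x :=
  ⟨hJ, fun s hs t ht => h.2 s (hJI hs) t (hJI ht)⟩

theorem IsSolutionOn.congr (h : IsSolutionOn f I x) (hxy : EqOn x y I) : IsSolutionOn f I y := by
  refine ⟨h.1, fun s hs t ht => ?_⟩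
  have hst : uIcc s t ⊆ I := h.1.uIcc_subset hs ht
  have e : EqOn (fun τ => f τ (x τ)) (fun τ => f τ (y τ)) (uIcc s t) := fun τ hτ => by
    simp only [hxy (hst hτ)]
  obtain ⟨h1, h2⟩ := h.2 s hs t ht
  refine ⟨h1.congr (e.mono uIoc_subset_uIcc), ?_⟩
  rw [← hxy hs, ← hxy ht, h2, intervalIntegral.integral_congr e]

/-- Reduces local statements on a general interval to compact ones. If `t` is an endpoint belonging
to `I`, the compact interval is one-sided there. -/
theorem exists_Icc_mem_nhdsWithin {t : ℝ} (ht : t ∈ I) :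
    ∃ a ∈ I, ∃ b ∈ I, t ∈ Icc a b ∧ Icc a b ∈ 𝓝[I] t := by
  have hl : ∃ a ∈ I, a ≤ t ∧ Ici a ∈ 𝓝[I] t := by
    by_cases hc : ∃ a ∈ I, a < t
    · obtain ⟨a, ha, hat⟩ := hc
      exact ⟨a, ha, hat.le, mem_nhdsWithin_of_mem_nhds (Ici_mem_nhds hat)⟩
    · push Not at hc
      exact ⟨t, ht, le_rfl, Filter.mem_of_superset self_mem_nhdsWithin hc⟩
  have hr : ∃ b ∈ I, t ≤ b ∧ Iic b ∈ 𝓝[I] t := by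
    by_cases hc : ∃ a ∈ I, t < a
    · obtain ⟨a, ha, hat⟩ := hc
      exact ⟨a, ha, hat.le, mem_nhdsWithin_of_mem_nhds (Iic_mem_nhds hat)⟩
    · push Not at hc
      exact ⟨t, ht, le_rfl, Filter.mem_of_superset self_mem_nhdsWithin hc⟩
  obtain ⟨a, ha, hat, ha'⟩ := hl
  obtain ⟨b, hb, htb, hb'⟩ := hr
  exact ⟨a, ha, b, hb, ⟨hat, htb⟩, Filter.inter_mem ha' hb'⟩

theorem continuousOn_of_eq_add_integral {E : Type*} [NormedAddCommGroup E] [NormedSpace ℝ E]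
    {w v : ℝ → E} (hI : I.OrdConnected)
    (h : ∀ s ∈ I, ∀ t ∈ I, IntervalIntegrable v volume s t ∧ w t = w s + ∫ τ in s..t, v τ) :
    ContinuousOn w I := by
  intro t ht
  obtain ⟨a, ha, b, hb, htab, hab⟩ := exists_Icc_mem_nhdsWithin ht
  have h1 := intervalIntegral.continuousOn_primitive_interval' (h a ha b hb).1
    (left_mem_uIcc (a := a) (b := b))
  rw [uIcc_of_le (htab.1.trans htab.2)] at h1
  have h2 : ContinuousOn w (Icc a b) := (continuousOn_const (c := w a)).add h1 |>.congr
    fun s hs => (h a ha s (hI.out ha hb hs)).2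
  exact (h2 t htab).mono_of_mem_nhdsWithin hab

theorem IsSolutionOn.continuousOn_coe (h : IsSolutionOn f I x) :
    ContinuousOn (fun t => (x t : F)) I :=
  continuousOn_of_eq_add_integral h.1 h.2

theorem IsSolutionOn.continuousOn (h : IsSolutionOn f I x) : ContinuousOn x I := by
  rw [Topology.IsInducing.subtypeVal.continuousOn_iff]
  exact h.continuousOn_coe

/-- If a continuous function is the derivative in the integral sense, it is the derivative. -/
theorem hasDerivWithinAt_of_eq_add_integral {E : Type*} [NormedAddCommGroup E] [NormedSpace ℝ E]
    [CompleteSpace E] {w v : ℝ → E} (hI : I.OrdConnected) (hv : ContinuousOn v I)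
    (h : ∀ s ∈ I, ∀ t ∈ I, w t = w s + ∫ τ in s..t, v τ) {t : ℝ} (ht : t ∈ I) :
    HasDerivWithinAt w (v t) I t := by
  obtain ⟨a, ha, b, hb, htab, hab⟩ := exists_Icc_mem_nhdsWithin ht
  have hsub : Icc a b ⊆ I := hI.out ha hb
  have hv' : ContinuousOn v (Icc a b) := hv.mono hsub
  have : Fact (t ∈ Icc a b) := ⟨htab⟩
  have h1 : HasDerivWithinAt (fun s => w a + ∫ τ in a..s, v τ) (v t) (Icc a b) t :=
    (intervalIntegral.integral_hasDerivWithinAt_right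
      ((hv'.mono (Icc_subset_Icc le_rfl htab.2)).intervalIntegrable_of_Icc htab.1)
      (hv'.stronglyMeasurableAtFilter_nhdsWithin measurableSet_Icc t) (hv' t htab)).const_add (w a)
  exact (h1.congr (fun s hs => h a ha s (hsub hs)) (h a ha t ht)).mono_of_mem_nhdsWithin hab

/-- Two solutions that agree at one instant agree on the common interval of definition. -/
def HasUniqueSolutions (f : ℝ → M → F) : Prop :=
  ∀ (I J : Set ℝ) (x y : ℝ → M) (t₀ : ℝ), IsSolutionOn f I x → IsSolutionOn f J y →
    t₀ ∈ I → t₀ ∈ J → x t₀ = y t₀ → EqOn x y (I ∩ J)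

-- All solutions through `(t₀, x₀)` are glued: their intervals share `t₀`, so the union is an
-- interval, and uniqueness makes the values consistent. No existence theorem is needed, because a
-- constant on `{t₀}` is already a solution.
open Classical in
theorem HasUniqueSolutions.exists_isMaximalSolution (hf : HasUniqueSolutions f) (t₀ : ℝ) (x₀ : M) :
    ∃ (I : Set ℝ) (x : ℝ → M), IsMaximalSolution f t₀ x₀ I x ∧
      ∀ (J : Set ℝ) (y : ℝ → M), IsSolutionOn f J y → t₀ ∈ J → y t₀ = x₀ → J ⊆ I ∧ EqOn y x J := by
  let 𝒮 : Set (Set ℝ × (ℝ → M)) := {p | IsSolutionOn f p.1 p.2 ∧ t₀ ∈ p.1 ∧ p.2 t₀ = x₀}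
  let I : Set ℝ := {t | ∃ p ∈ 𝒮, t ∈ p.1}
  let x : ℝ → M := fun t => if h : ∃ p ∈ 𝒮, t ∈ p.1 then h.choose.2 t else x₀
  have hx : ∀ p ∈ 𝒮, EqOn p.2 x p.1 := by
    intro p hp t ht
    have h : ∃ p ∈ 𝒮, t ∈ p.1 := ⟨p, hp, ht⟩
    have hc := h.choose_spec
    simp only [x, dif_pos h]
    exact hf _ _ _ _ t₀ hp.1 hc.1.1 hp.2.1 hc.1.2.1 (hp.2.2.trans hc.1.2.2.symm) ⟨ht, hc.2⟩
  have hsub : ∀ p ∈ 𝒮, p.1 ⊆ I := fun p hp t ht => ⟨p, hp, ht⟩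
  have htriv : (({t₀} : Set ℝ), fun _ : ℝ => x₀) ∈ 𝒮 := by
    refine ⟨⟨ordConnected_singleton, ?_⟩, rfl, rfl⟩
    rintro s rfl t rfl
    simp
  have ht₀ : t₀ ∈ I := ⟨_, htriv, rfl⟩
  have hx₀ : x t₀ = x₀ := (hx _ htriv (mem_singleton t₀)).symm
  have hI : I.OrdConnected := by
    have : I = ⋃ p : 𝒮, p.1.1 := by
      ext t
      exact ⟨fun ⟨p, hp, h⟩ => mem_iUnion.2 ⟨⟨p, hp⟩, h⟩,
        fun h => (mem_iUnion.1 h).elim fun p h => ⟨p.1, p.2, h⟩⟩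
    rw [this]
    exact (isPreconnected_iUnion ⟨t₀, mem_iInter.2 fun p : 𝒮 => p.2.2.1⟩ fun p =>
      p.2.1.1.isPreconnected).ordConnected
  -- One member of the family need not contain two given times `s` and `t`, but each lies in a
  -- member together with `t₀`; the integral equation is obtained through `t₀`.
  have hbase : ∀ t ∈ I, IntervalIntegrable (fun τ => f τ (x τ)) volume t₀ t ∧
      (x t : F) = x t₀ + ∫ τ in t₀..t, f τ (x τ) := by
    rintro t ⟨p, hp, ht⟩
    exact (hp.1.congr (hx p hp)).2 t₀ hp.2.1 t ht
  have hsol : IsSolutionOn f I x := by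
    refine ⟨hI, fun s hs t ht => ?_⟩
    obtain ⟨i1, e1⟩ := hbase s hs
    obtain ⟨i2, e2⟩ := hbase t ht
    refine ⟨i1.symm.trans i2, ?_⟩
    rw [← intervalIntegral.integral_add_adjacent_intervals i1.symm i2, e1, e2,
      intervalIntegral.integral_symm t₀ s]
    abel
  refine ⟨I, x, ⟨ht₀, hx₀, hsol, fun J y hy hIJ hyx => ?_⟩, fun J y hy htJ hyt => ?_⟩
  · exact Subset.antisymm (hsub (J, y) ⟨hy, hIJ ht₀, (hyx ht₀).trans hx₀⟩) hIJ
  · exact ⟨hsub (J, y) ⟨hy, htJ, hyt⟩, hx (J, y) ⟨hy, htJ, hyt⟩⟩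

theorem HasUniqueSolutions.hasUniqueMaximalSolutions (hf : HasUniqueSolutions f) :
    HasUniqueMaximalSolutions f := by
  intro t₀ x₀
  obtain ⟨I, x, hx, hmax⟩ := hf.exists_isMaximalSolution t₀ x₀
  refine ⟨I, x, hx, fun J y hy => ?_⟩
  obtain ⟨hJI, hyx⟩ := hmax J y hy.2.2.1 hy.1 hy.2.1
  obtain rfl := hy.2.2.2 I x hx.2.2.1 hJI hyx.symm
  exact ⟨rfl, hyx⟩

/-- A maximal solution is defined wherever some solution through one of its points is defined. -/
theorem IsMaximalSolution.subset (hf : HasUniqueSolutions f) {t₀ t₁ : ℝ} {x₀ : M}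
    (hx : IsMaximalSolution f t₀ x₀ I x) (ht₁ : t₁ ∈ I) (hy : IsSolutionOn f J y) (htJ : t₁ ∈ J)
    (hyx : y t₁ = x t₁) : J ⊆ I := by
  obtain ⟨I', x', hx', hmax⟩ := hf.exists_isMaximalSolution t₁ (x t₁)
  obtain ⟨h1, h2⟩ := hmax I x hx.2.2.1 ht₁ rfl
  have h3 := hx.2.2.2 I' x' hx'.2.2.1 h1 h2.symm
  exact h3 ▸ (hmax J y hy htJ hyx).1

/-- Solutions of conjugate systems correspond to each other. -/
theorem isMaximalSolution_conj {f' : ℝ → M → F} (φ : ℝ → M ≃ M)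
    (h : ∀ (I : Set ℝ) (x : ℝ → M), IsSolutionOn f I x ↔ IsSolutionOn f' I fun t => φ t (x t))
    {t₀ : ℝ} {x₀ : M} (hx : IsMaximalSolution f t₀ x₀ I x) :
    IsMaximalSolution f' t₀ (φ t₀ x₀) I fun t => φ t (x t) := by
  refine ⟨hx.1, by simp only [hx.2.1], (h I x).1 hx.2.2.1, fun J y hy hIJ hyx => ?_⟩
  refine hx.2.2.2 J (fun t => (φ t).symm (y t)) ((h _ _).2 (by simpa using hy)) hIJ
    fun t ht => ?_
  simp [hyx ht]

theorem hasUniqueSolutions_conj {f' : ℝ → M → F} (φ : ℝ → M ≃ M)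
    (h : ∀ (I : Set ℝ) (x : ℝ → M), IsSolutionOn f I x ↔ IsSolutionOn f' I fun t => φ t (x t))
    (hf' : HasUniqueSolutions f') : HasUniqueSolutions f := by
  intro I J x y t₀ hx hy hI hJ hxy t ht
  have := hf' I J _ _ t₀ ((h _ _).1 hx) ((h _ _).1 hy) hI hJ (by simp only [hxy]) ht
  exact (φ t).injective this

end Solutions

/-! ## Integral inequalities and integration by parts -/

/-- **Grönwall's inequality**, integral form. -/
theorem le_mul_exp_of_le_add_integral {z : ℝ → ℝ} {a b ε L : ℝ} (hz : ContinuousOn z (Icc a b))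
    (hL : 0 ≤ L) (h : ∀ t ∈ Icc a b, z t ≤ ε + L * ∫ τ in a..t, z τ) :
    ∀ t ∈ Icc a b, z t ≤ ε * Real.exp (L * (t - a)) := by
  intro t ht
  have hab : a ≤ b := ht.1.trans ht.2
  have hder : ∀ x ∈ Icc a b, HasDerivWithinAt (fun t => ∫ τ in a..t, z τ) (z x) (Icc a b) x := by
    intro x hx
    refine hasDerivWithinAt_of_eq_add_integral ordConnected_Icc hz (fun s hs t ht => ?_) hx
    rw [intervalIntegral.integral_add_adjacent_intervals]
    · exact (hz.mono (Icc_subset_Icc le_rfl hs.2)).intervalIntegrable_of_Icc hs.1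
    · exact (hz.mono (uIcc_subset_Icc hs ht)).intervalIntegrable
  -- The differential inequality holds for the primitive `W` of `z`, namely `W' ≤ ε + L W` with
  -- `W(a) = 0`; the bound on `W` is then inserted into the hypothesis on `z`.
  have hw := le_gronwallBound_of_liminf_deriv_right_le (f := fun t => ∫ τ in a..t, z τ) (f' := z)
    (δ := 0) (K := L) (ε := ε) (a := a) (b := b) (fun x hx => (hder x hx).continuousWithinAt)
    (fun x hx r hr => ((hder x ⟨hx.1, hx.2.le⟩).mono_of_mem_nhdsWithin
      (Icc_mem_nhdsGE_of_mem hx)).liminf_right_slope_le hr)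
    (by simp) (fun x hx => by linarith [h x ⟨hx.1, hx.2.le⟩]) t ht
  have h1 := h t ht
  rcases hL.eq_or_lt with rfl | hL'
  · simpa using h1
  · rw [gronwallBound_of_K_ne_0 hL'.ne'] at hw
    refine h1.trans ((add_le_add_right (mul_le_mul_of_nonneg_left hw hL) ε).trans_eq ?_)
    field_simp
    ring

/-- Integration by parts when `G` is only an indefinite integral, as needed for a merely measurable
dither. Testing with continuous functionals reduces it to the product rule for real absolutely
continuous functions; `c` qualifies because a bounded derivative makes it Lipschitz. -/
theorem integral_smul_add_smul_eq_sub {B : Type*} [NormedAddCommGroup B] [NormedSpace ℝ B]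
    [CompleteSpace B] {g G : ℝ → ℝ} {c c' : ℝ → B} {a b : ℝ}
    (hg : IntervalIntegrable g volume a b)
    (hG : ∀ t ∈ uIcc a b, G t = G a + ∫ τ in a..t, g τ)
    (hc : ∀ t ∈ uIcc a b, HasDerivWithinAt c (c' t) (uIcc a b) t)
    (hc' : ContinuousOn c' (uIcc a b)) :
    IntervalIntegrable (fun t => g t • c t + G t • c' t) volume a b ∧
      ∫ t in a..b, (g t • c t + G t • c' t) = G b • c b - G a • c a := by
  have hcc : ContinuousOn c (uIcc a b) := fun t ht => (hc t ht).continuousWithinAt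
  have hprim : ContinuousOn (fun t => ∫ τ in a..t, g τ) (uIcc a b) :=
    intervalIntegral.continuousOn_primitive_interval' hg left_mem_uIcc
  have hGc : ContinuousOn G (uIcc a b) := (continuousOn_const.add hprim).congr hG
  have hi1 : IntervalIntegrable (fun t => g t • c t) volume a b := hg.smul_continuousOn hcc
  have hi2 : IntervalIntegrable (fun t => G t • c' t) volume a b :=
    (hGc.smul hc').intervalIntegrable
  refine ⟨hi1.add hi2, ?_⟩
  have hGac : AbsolutelyContinuousOnInterval (fun t => ∫ τ in a..t, g τ) a b :=
    hg.absolutelyContinuousOnInterval_intervalIntegral left_mem_uIcc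
  refine (SeparatingDual.eq_iff_forall_dual_eq (R := ℝ)).2 fun ℓ => ?_
  rw [← ContinuousLinearMap.intervalIntegral_comp_comm ℓ (hi1.add hi2)]
  obtain ⟨C, hC⟩ := isCompact_uIcc.exists_bound_of_continuousOn hc'
  have hcL : LipschitzOnWith (‖ℓ‖₊ * C.toNNReal) (fun t => ℓ (c t)) (uIcc a b) := by
    have := (convex_uIcc a b).lipschitzOnWith_of_nnnorm_hasDerivWithin_le (C := C.toNNReal) hc
      fun t ht => by
        rw [← NNReal.coe_le_coe, coe_nnnorm]
        exact (hC t ht).trans (Real.le_coe_toNNReal C)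
    exact ℓ.lipschitz.comp_lipschitzOnWith this
  have hcac := hcL.absolutelyContinuousOnInterval
  have key := hGac.integral_deriv_mul_eq_sub hcac
  have hca : ∫ t in a..b, ℓ (c' t) = ℓ (c b) - ℓ (c a) := by
    rw [intervalIntegral.integral_eq_sub_of_hasDeriv_right (f := fun t => ℓ (c t))
      (f' := fun t => ℓ (c' t)) (ℓ.continuous.comp_continuousOn hcc)]
    · intro x hx
      have hx' : x ∈ uIcc a b := Ioo_subset_Icc_self hx
      have := (hc x hx').hasDerivAt (Icc_mem_nhds hx.1 hx.2)
      exact (ℓ.hasFDerivAt.comp_hasDerivAt x this).hasDerivWithinAt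
    · exact (ℓ.continuous.comp_continuousOn hc').intervalIntegrable
  -- The product rule is used for the primitive vanishing at `a`; the constant `G a` is split off.
  -- The endpoints are discarded below because there `uIcc a b` is not a neighbourhood.
  have h1 : ∫ t in a..b, ℓ (g t • c t + G t • c' t) =
      (∫ t in a..b, (deriv (fun t => ∫ τ in a..t, g τ) t * ℓ (c t) +
        (∫ τ in a..t, g τ) * deriv (fun t => ℓ (c t)) t)) + G a * ∫ t in a..b, ℓ (c' t) := by
    rw [← intervalIntegral.integral_const_mul, ← intervalIntegral.integral_add]
    · refine intervalIntegral.integral_congr_ae ?_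
      have hne : ∀ᵐ t : ℝ, t ≠ a ∧ t ≠ b := by
        have h1 : ∀ᵐ t : ℝ, t ≠ a := Measure.ae_ne volume a
        have h2 : ∀ᵐ t : ℝ, t ≠ b := Measure.ae_ne volume b
        filter_upwards [h1, h2] with t h h' using ⟨h, h'⟩
      filter_upwards [hg.ae_hasDerivAt_integral, hne] with t ht hne htm
      have htm' : t ∈ uIcc a b := uIoc_subset_uIcc htm
      have hto : uIcc a b ∈ 𝓝 t := by
        rcases le_total a b with hab | hab
        · rw [uIcc_of_le hab] at htm' ⊢
          exact Icc_mem_nhds (lt_of_le_of_ne htm'.1 hne.1.symm) (lt_of_le_of_ne htm'.2 hne.2)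
        · rw [uIcc_of_ge hab] at htm' ⊢
          exact Icc_mem_nhds (lt_of_le_of_ne htm'.1 hne.2.symm) (lt_of_le_of_ne htm'.2 hne.1)
      have e1 := (ht htm' a left_mem_uIcc).deriv
      have e2 : deriv (fun t => ℓ (c t)) t = ℓ (c' t) :=
        (ℓ.hasFDerivAt.comp_hasDerivAt t ((hc t htm').hasDerivAt hto)).deriv
      rw [e1, e2, hG t htm']
      simp only [map_add, map_smul, smul_eq_mul]
      ring
    · exact (hGac.intervalIntegrable_deriv.mul_continuousOn hcac.continuousOn).add
        (hcac.intervalIntegrable_deriv.continuousOn_mul hGac.continuousOn)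
    · exact ((ℓ.continuous.comp_continuousOn hc').intervalIntegrable).const_mul _
  rw [h1, key, hca, hG b right_mem_uIcc]
  simp only [map_sub, map_smul, smul_eq_mul, intervalIntegral.integral_same]
  ring

/-! ## Smooth maps on subsets of normed spaces -/

section Smooth

variable {A B C A' : Type*} [NormedAddCommGroup A] [NormedSpace ℝ A] [NormedAddCommGroup B]
    [NormedSpace ℝ B] [NormedAddCommGroup C] [NormedSpace ℝ C] [NormedAddCommGroup A']
    [NormedSpace ℝ A'] {S : Set A} {S' : Set A'}

theorem IsSmooth.exists_contDiffAt {f : S → B} (hf : IsSmooth f) (p : S) :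
    ∃ U : Set A, IsOpen U ∧ (p : A) ∈ U ∧ ∃ g : A → B, ContDiffOn ℝ (⊤ : ℕ∞) g U ∧
      ContDiffAt ℝ (⊤ : ℕ∞) g p ∧ ∀ y : S, (y : A) ∈ U → f y = g y := by
  obtain ⟨U, hU, hp, g, hg, h⟩ := hf p
  exact ⟨U, hU, hp, g, hg, hg.contDiffAt (hU.mem_nhds hp), h⟩

theorem IsSmooth.of_contDiff {g : A → B} (hg : ContDiff ℝ (⊤ : ℕ∞) g) :
    IsSmooth (fun p : S => g p) :=
  fun _ => ⟨univ, isOpen_univ, mem_univ _, g, hg.contDiffOn, fun _ _ => rfl⟩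

theorem IsSmooth.comp {f : S → B} (hf : IsSmooth f) {φ : S' → S}
    (hφ : IsSmooth fun p => (φ p : A)) : IsSmooth fun p => f (φ p) := by
  intro p
  obtain ⟨U, hU, hp, g, hg, h⟩ := hφ p
  obtain ⟨V, hV, hq, k, hk, h'⟩ := hf (φ p)
  refine ⟨U ∩ g ⁻¹' V, hg.continuousOn.isOpen_inter_preimage hU hV, ⟨hp, ?_⟩, k ∘ g,
    hk.comp (hg.mono inter_subset_left) inter_subset_right, fun y hy => ?_⟩
  · rw [mem_preimage, ← h p hp]; exact hq
  · have e : (φ y : A) = g y := h y hy.1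
    have hy' : (φ y : A) ∈ V := e ▸ hy.2
    simp only [h' _ hy', e, Function.comp_apply]

theorem IsSmooth.contDiff_comp {f : S → B} (hf : IsSmooth f) {k : B → C}
    (hk : ContDiff ℝ (⊤ : ℕ∞) k) : IsSmooth fun p => k (f p) := by
  intro p
  obtain ⟨U, hU, hp, g, hg, h⟩ := hf p
  exact ⟨U, hU, hp, k ∘ g, hk.comp_contDiffOn hg,
    fun y hy => by simp only [h y hy, Function.comp_apply]⟩

theorem IsSmooth.prodMk {f : S → B} {g : S → C} (hf : IsSmooth f) (hg : IsSmooth g) :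
    IsSmooth fun p => (f p, g p) := by
  intro p
  obtain ⟨U, hU, hp, k, hk, h⟩ := hf p
  obtain ⟨V, hV, hq, l, hl, h'⟩ := hg p
  exact ⟨U ∩ V, hU.inter hV, ⟨hp, hq⟩, fun y => (k y, l y),
    (hk.mono inter_subset_left).prodMk (hl.mono inter_subset_right),
    fun y hy => by simp only [h y hy.1, h' y hy.2]⟩

theorem IsSmooth.add {f g : S → B} (hf : IsSmooth f) (hg : IsSmooth g) :
    IsSmooth fun p => f p + g p :=
  (hf.prodMk hg).contDiff_comp (k := fun x : B × B => x.1 + x.2) (by fun_prop)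

theorem IsSmooth.neg {f : S → B} (hf : IsSmooth f) : IsSmooth fun p => -f p :=
  hf.contDiff_comp (k := fun x : B => -x) (by fun_prop)

theorem IsSmooth.sub {f g : S → B} (hf : IsSmooth f) (hg : IsSmooth g) :
    IsSmooth fun p => f p - g p :=
  (hf.prodMk hg).contDiff_comp (k := fun x : B × B => x.1 - x.2) (by fun_prop)

theorem IsSmooth.smul {f : S → ℝ} {g : S → B} (hf : IsSmooth f) (hg : IsSmooth g) :
    IsSmooth fun p => f p • g p :=
  (hf.prodMk hg).contDiff_comp (k := fun x : ℝ × B => x.1 • x.2) (by fun_prop)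

theorem IsSmooth.mul {f g : S → ℝ} (hf : IsSmooth f) (hg : IsSmooth g) :
    IsSmooth fun p => f p * g p :=
  hf.smul hg

theorem IsSmooth.const (c : B) : IsSmooth fun _ : S => c :=
  IsSmooth.of_contDiff (g := fun _ : A => c) contDiff_const

theorem IsSmooth.sum {ι : Type*} {s : Finset ι} {f : ι → S → B} (hf : ∀ i ∈ s, IsSmooth (f i)) :
    IsSmooth fun p => ∑ i ∈ s, f i p := by
  classical
  induction s using Finset.induction_on with
  | empty => simpa using IsSmooth.const (0 : B)
  | insert i s hi ih =>
    simp only [Finset.sum_insert hi]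
    exact (hf i (Finset.mem_insert_self i s)).add
      (ih fun j hj => hf j (Finset.mem_insert_of_mem hj))

theorem IsSmooth.locallyLipschitz {f : S → B} (hf : IsSmooth f) : LocallyLipschitz f := by
  intro p
  obtain ⟨U, hU, hp, g, hg, hg', h⟩ := hf.exists_contDiffAt p
  obtain ⟨K, t, ht, hK⟩ :=
    (hg'.of_le (m := 1) (by exact_mod_cast le_top)).exists_lipschitzOnWith
  refine ⟨K, Subtype.val ⁻¹' (U ∩ t), ?_, ?_⟩
  · exact continuous_subtype_val.continuousAt.preimage_mem_nhds
      (Filter.inter_mem (hU.mem_nhds hp) ht)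
  · intro x hx y hy
    rw [h x hx.1, h y hy.1]
    exact hK hx.2 hy.2

theorem IsSmooth.continuous {f : S → B} (hf : IsSmooth f) : Continuous f :=
  hf.locallyLipschitz.continuous

/-- The ambient extension of `f` varies from point to point, but unique differentiability of `I`
identifies every local chain-rule derivative with `derivWithin`, so continuity can be read off from
any local extension. -/
theorem IsSmooth.exists_hasDerivWithinAt {f : S → B} (hf : IsSmooth f) {x : ℝ → S} {x' : ℝ → A}
    {I : Set ℝ} (hx : ∀ t ∈ I, HasDerivWithinAt (fun t => (x t : A)) (x' t) I t)
    (hx' : ContinuousOn x' I) (hI : UniqueDiffOn ℝ I) :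
    ∃ c' : ℝ → B, ContinuousOn c' I ∧ ∀ t ∈ I, HasDerivWithinAt (fun t => f (x t)) (c' t) I t := by
  have hxc : ContinuousOn (fun t => (x t : A)) I := fun t ht => (hx t ht).continuousWithinAt
  have key : ∀ t ∈ I, ∃ U : Set A, IsOpen U ∧ (x t : A) ∈ U ∧ ∃ g : A → B,
      ContDiffOn ℝ (⊤ : ℕ∞) g U ∧ ∀ s ∈ I, (x s : A) ∈ U →
        HasDerivWithinAt (fun t => f (x t)) (fderiv ℝ g (x s) (x' s)) I s := by
    intro t ht
    obtain ⟨U, hU, hp, g, hg, h⟩ := hf (x t)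
    refine ⟨U, hU, hp, g, hg, fun s hs hsU => ?_⟩
    have hd : HasFDerivAt g (fderiv ℝ g (x s)) (x s) :=
      ((hg.contDiffAt (hU.mem_nhds hsU)).differentiableAt (by simp)).hasFDerivAt
    have h1 := hd.comp_hasDerivWithinAt s (hx s hs)
    refine h1.congr_of_eventuallyEq ?_ (h (x s) hsU)
    filter_upwards [(hxc s hs).preimage_mem_nhdsWithin (hU.mem_nhds hsU)] with r hr
    exact h (x r) hr
  refine ⟨derivWithin (fun t => f (x t)) I, fun t ht => ?_, fun t ht => ?_⟩
  · obtain ⟨U, hU, hp, g, hg, h⟩ := key t ht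
    have h1 : ContinuousWithinAt (fun s => fderiv ℝ g (x s) (x' s)) I t := by
      have h2 : ContinuousAt (fderiv ℝ g) (x t) :=
        (hg.contDiffAt (hU.mem_nhds hp)).continuousAt_fderiv (by simp)
      exact (h2.comp_continuousWithinAt (f := fun s => (x s : A)) (hxc t ht)).clm_apply (hx' t ht)
    refine h1.congr_of_eventuallyEq ?_ ((h t ht hp).derivWithin (hI t ht))
    filter_upwards [(hxc t ht).preimage_mem_nhdsWithin (hU.mem_nhds hp), self_mem_nhdsWithin]
      with s hs hsI
    exact (h s hsI hs).derivWithin (hI s hsI)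
  · obtain ⟨U, hU, hp, g, hg, h⟩ := key t ht
    exact (h t ht hp).differentiableWithinAt.hasDerivWithinAt

/-- The span of the velocities at `p` of curves in `S`. -/
def velocitySpan (S : Set A) (p : A) : Submodule ℝ A :=
  Submodule.span ℝ {v | ∃ γ : ℝ → A, γ 0 = p ∧ (∀ᶠ t in 𝓝 (0 : ℝ), γ t ∈ S) ∧ HasDerivAt γ v 0}

/-- By the chain rule both maps give the derivative of `f` along a curve in `S`, hence they agree on
velocities and on their span. This makes derivatives on `Q` independent of extensions. -/
theorem velocitySpan_eq_of_hasFDerivWithinAt {f : A → B} {f₁ f₂ : A →L[ℝ] B} {p v : A}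
    (h₁ : HasFDerivWithinAt f f₁ S p) (h₂ : HasFDerivWithinAt f f₂ S p)
    (hv : v ∈ velocitySpan S p) : f₁ v = f₂ v := by
  have : velocitySpan S p ≤ LinearMap.eqLocus f₁.toLinearMap f₂.toLinearMap := by
    refine Submodule.span_le.2 ?_
    rintro w ⟨γ, rfl, hγ, hw⟩
    exact (h₁.comp_hasDerivAt 0 hw hγ).unique (h₂.comp_hasDerivAt 0 hw hγ)
  exact this hv

/-- A set is a local smooth retract if it is, locally around each of its points, the set of fixed
points of a smooth retraction. -/
def IsLocalSmoothRetract (S : Set A) : Prop :=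
  ∀ p ∈ S, ∃ (U : Set A) (r : A → A), IsOpen U ∧ p ∈ U ∧ ContDiffOn ℝ (⊤ : ℕ∞) r U ∧
    (∀ x ∈ U, r x ∈ S) ∧ ∀ x ∈ U, x ∈ S → r x = x

/-- On `S` near `p` the retraction coincides with the identity, so the two derivatives agree on
tangent vectors. -/
theorem fderiv_retraction_apply {U : Set A} {r : A → A} (hU : IsOpen U)
    (hr : ContDiffOn ℝ (⊤ : ℕ∞) r U) (hrS : ∀ x ∈ U, x ∈ S → r x = x) {p v : A} (hpU : p ∈ U)
    (hpS : p ∈ S) (hv : v ∈ velocitySpan S p) : fderiv ℝ r p v = v := by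
  have h1 : HasFDerivAt r (fderiv ℝ r p) p :=
    ((hr.contDiffAt (hU.mem_nhds hpU)).differentiableAt (by simp)).hasFDerivAt
  have h2 : HasFDerivWithinAt r (ContinuousLinearMap.id ℝ A) S p := by
    refine (hasFDerivWithinAt_id p S).congr_of_eventuallyEq ?_ (hrS p hpU hpS)
    filter_upwards [self_mem_nhdsWithin, mem_nhdsWithin_of_mem_nhds (hU.mem_nhds hpU)] with x hx hxU
    exact hrS x hxU hx
  exact velocitySpan_eq_of_hasFDerivWithinAt h1.hasFDerivWithinAt h2 hv

/-- The retraction sends a straight segment through `p` to a curve in `S`. At points of `S`, this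
and `fderiv_retraction_apply` say that the derivative of `r` is a projection onto the tangent space.
-/
theorem fderiv_retraction_mem_velocitySpan {U : Set A} {r : A → A} (hU : IsOpen U)
    (hr : ContDiffOn ℝ (⊤ : ℕ∞) r U) (hrS : ∀ x ∈ U, r x ∈ S) {p : A} (hpU : p ∈ U) (v : A) :
    fderiv ℝ r p v ∈ velocitySpan S (r p) := by
  have hγ : HasDerivAt (fun t : ℝ => p + t • v) v 0 := by
    simpa using ((hasDerivAt_id (0 : ℝ)).smul_const v).const_add p
  have h1 : HasFDerivAt r (fderiv ℝ r p) (p + (0 : ℝ) • v) := by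
    simpa using ((hr.contDiffAt (hU.mem_nhds hpU)).differentiableAt (by simp)).hasFDerivAt
  refine Submodule.subset_span ⟨fun t => r (p + t • v), by simp, ?_, h1.comp_hasDerivAt 0 hγ⟩
  have : ∀ᶠ t in 𝓝 (0 : ℝ), p + t • v ∈ U :=
    hγ.continuousAt.eventually_mem (by simpa using hU.mem_nhds hpU)
  exact this.mono fun t ht => hrS _ ht

/-- In `U` the set is the closed locus `r x = x`. The averaging argument needs the resulting local
compactness to thicken compact sets inside `M`. -/
theorem IsLocalSmoothRetract.isLocallyClosed (hS : IsLocalSmoothRetract S) : IsLocallyClosed S := by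
  refine ((isLocallyClosed_tfae S).out 0 2).2 fun p hp => ?_
  obtain ⟨U, r, hU, hpU, hr, hrS, hrS'⟩ := hS p hp
  refine ⟨U, hU.mem_nhds hpU, ?_⟩
  have : (Subtype.val ⁻¹' S : Set U) = {x : U | r x = x} := by
    ext x
    exact ⟨fun h => hrS' x x.2 h, fun h => by
      have := hrS x x.2
      rwa [show r x = x from h] at this⟩
  rw [this]
  exact isClosed_eq (continuousOn_iff_continuous_domRestrict.1 hr.continuousOn) continuous_subtype_val

end Smooth

/-! ## Systems driven by time-dependent amplitudes -/

section Modulated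

variable {F : Type*} [NormedAddCommGroup F] [NormedSpace ℝ F] {M : Set F} {ι : Type*} [Fintype ι]

/-- The field `∑ g_k(t) X_k(x)`. -/
def modulatedField (g : ι → ℝ → ℝ) (X : ι → M → F) (t : ℝ) (x : M) : F := ∑ k, g k t • X k x

/-- The constant depends on the amplitudes only through `B`, so after rescaling time it is uniform
in `ω`; the same holds for the Lipschitz estimate that follows. -/
theorem exists_norm_modulatedField_le {X : ι → M → F} (hX : ∀ k, Continuous (X k)) {K : Set M}
    (hK : IsCompact K) (B : ι → ℝ) :
    ∃ C : ℝ, 0 < C ∧ ∀ (g : ι → ℝ → ℝ) (t : ℝ), (∀ k, |g k t| ≤ B k) → ∀ x ∈ K,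
      ‖modulatedField g X t x‖ ≤ C := by
  choose C hC using fun k => hK.exists_bound_of_continuousOn (hX k).continuousOn
  refine ⟨1 + ∑ k, |B k| * |C k|, by positivity, fun g t hg x hx => ?_⟩
  refine (norm_sum_le_of_le _ (n := fun k => |B k| * |C k|) fun k _ => ?_).trans (by linarith)
  rw [norm_smul, Real.norm_eq_abs]
  exact mul_le_mul ((hg k).trans (le_abs_self _)) ((hC k x hx).trans (le_abs_self _))
    (norm_nonneg _) (abs_nonneg _)

theorem exists_norm_modulatedField_sub_le {X : ι → M → F} (hX : ∀ k, LocallyLipschitz (X k))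
    {K : Set M} (hK : IsCompact K) (B : ι → ℝ) :
    ∃ L : ℝ, 0 ≤ L ∧ ∀ (g : ι → ℝ → ℝ) (t : ℝ), (∀ k, |g k t| ≤ B k) → ∀ x ∈ K, ∀ y ∈ K,
      ‖modulatedField g X t x - modulatedField g X t y‖ ≤ L * ‖(x : F) - y‖ := by
  choose L hL using fun k =>
    ((hX k).locallyLipschitzOn (s := K)).exists_lipschitzOnWith_of_compact hK
  refine ⟨∑ k, |B k| * L k, by positivity, fun g t hg x hx y hy => ?_⟩
  rw [modulatedField, modulatedField, ← Finset.sum_sub_distrib, Finset.sum_mul]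
  refine norm_sum_le_of_le _ fun k _ => ?_
  rw [← smul_sub, norm_smul, Real.norm_eq_abs, mul_assoc]
  have := (hL k).dist_le_mul x hx y hy
  rw [dist_eq_norm, Subtype.dist_eq, dist_eq_norm] at this
  exact mul_le_mul ((hg k).trans (le_abs_self _)) this (norm_nonneg _) (abs_nonneg _)

theorem continuousOn_modulatedField {g : ι → ℝ → ℝ} (hg : ∀ k, Continuous (g k)) {X : ι → M → F}
    (hX : ∀ k, Continuous (X k)) {x : ℝ → M} {I : Set ℝ} (hx : ContinuousOn x I) :
    ContinuousOn (fun t => modulatedField g X t (x t)) I :=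
  continuousOn_finsetSum _ fun k _ =>
    (hg k).continuousOn.smul ((hX k).comp_continuousOn hx)

/-- Grönwall with `ε = 0` in both time directions; the backward case is the forward one for `t ↦ z
(-t)`. -/
theorem eqOn_zero_of_le_mul_abs_integral {z : ℝ → ℝ} {a b L : ℝ} (hz : ContinuousOn z (uIcc a b))
    (hL : 0 ≤ L) (h : ∀ t ∈ uIcc a b, z t ≤ L * |∫ τ in a..t, z τ|) (h0 : ∀ t, 0 ≤ z t) :
    z b = 0 := by
  refine le_antisymm ?_ (h0 b)
  rcases le_total a b with hab | hab
  · rw [uIcc_of_le hab] at hz h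
    have := le_mul_exp_of_le_add_integral (ε := 0) hz hL (fun t ht => ?_) b (right_mem_Icc.2 hab)
    · simpa using this
    · rw [zero_add]
      exact (h t ht).trans_eq
        (by rw [abs_of_nonneg (intervalIntegral.integral_nonneg ht.1 fun s _ => h0 s)])
  · rw [uIcc_of_ge hab] at hz h
    have hz' : ContinuousOn (fun t => z (-t)) (Icc (-a) (-b)) :=
      hz.comp continuous_neg.continuousOn fun t ht => ⟨by linarith [ht.2], by linarith [ht.1]⟩
    have := le_mul_exp_of_le_add_integral (ε := 0) hz' hL (fun t ht => ?_) (-b)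
      (right_mem_Icc.2 (by linarith))
    · simpa using this
    · rw [zero_add, intervalIntegral.integral_comp_neg, neg_neg]
      refine (h (-t) ⟨by linarith [ht.2], by linarith [ht.1]⟩).trans_eq ?_
      rw [intervalIntegral.integral_symm, abs_neg,
        abs_of_nonneg (intervalIntegral.integral_nonneg (by linarith [ht.1]) fun s _ => h0 s)]

/-- Over a compact time segment the two trajectories sweep out a compact set, on which the field is
Lipschitz uniformly in time; Grönwall then annihilates the distance. -/
theorem hasUniqueSolutions_modulatedField {g : ι → ℝ → ℝ} (hg : ∀ k, Continuous (g k))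
    {X : ι → M → F} (hX : ∀ k, LocallyLipschitz (X k)) :
    HasUniqueSolutions (modulatedField g X) := by
  intro I J x y t₀ hx hy hI hJ hxy t ht
  have hsI : uIcc t₀ t ⊆ I := hx.1.uIcc_subset hI ht.1
  have hsJ : uIcc t₀ t ⊆ J := hy.1.uIcc_subset hJ ht.2
  have hxc : ContinuousOn x (uIcc t₀ t) := hx.continuousOn.mono hsI
  have hyc : ContinuousOn y (uIcc t₀ t) := hy.continuousOn.mono hsJ
  choose B hB using fun k =>
    (isCompact_uIcc (a := t₀) (b := t)).exists_bound_of_continuousOn (hg k).continuousOn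
  obtain ⟨L, hL, hLip⟩ := exists_norm_modulatedField_sub_le hX
    ((isCompact_uIcc.image_of_continuousOn hxc).union (isCompact_uIcc.image_of_continuousOn hyc)) B
  have hzc : ContinuousOn (fun s => ‖(x s : F) - y s‖) (uIcc t₀ t) :=
    ((continuous_subtype_val.comp_continuousOn hxc).sub
      (continuous_subtype_val.comp_continuousOn hyc)).norm
  have hz := eqOn_zero_of_le_mul_abs_integral hzc hL (fun s hs => ?_) fun s => norm_nonneg _
  · exact Subtype.ext (sub_eq_zero.1 (norm_eq_zero.1 hz))
  · obtain ⟨i1, e1⟩ := hx.2 t₀ hI s (hsI hs)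
    obtain ⟨i2, e2⟩ := hy.2 t₀ hJ s (hsJ hs)
    have hsub : uIcc t₀ s ⊆ uIcc t₀ t := uIcc_subset_uIcc left_mem_uIcc hs
    rw [e1, e2, hxy, add_sub_add_left_eq_sub, ← intervalIntegral.integral_sub i1 i2,
      ← abs_of_nonneg hL, ← abs_mul, ← intervalIntegral.integral_const_mul]
    refine intervalIntegral.norm_integral_le_abs_of_norm_le
      ((ae_restrict_iff' measurableSet_uIoc).2 (.of_forall fun τ hτ => ?_))
      ((hzc.mono hsub).intervalIntegrable.const_mul _)
    have hτ' := hsub (uIoc_subset_uIcc hτ)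
    exact hLip g τ (fun k => hB k τ hτ') _ (Or.inl (mem_image_of_mem x hτ')) _
      (Or.inr (mem_image_of_mem y hτ'))

/-- The composition of a smooth map on `S` with a smooth retraction onto `S`. -/
theorem IsSmooth.exists_comp_retraction {A B : Type*} [NormedAddCommGroup A] [NormedSpace ℝ A]
    [NormedAddCommGroup B] [NormedSpace ℝ B] {S : Set A} {f : S → B} (hf : IsSmooth f)
    {U : Set A} {r : A → A} (hU : IsOpen U) (hr : ContDiffOn ℝ (⊤ : ℕ∞) r U)
    (hrS : ∀ x ∈ U, r x ∈ S) {p : A} (hp : p ∈ U) :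
    ∃ H : A → B, ContDiffAt ℝ (⊤ : ℕ∞) H p ∧ ∀ x (hx : x ∈ U), H x = f ⟨r x, hrS x hx⟩ := by
  classical
  obtain ⟨V, hV, hpV, k, hk, hk', h⟩ := hf.exists_contDiffAt ⟨r p, hrS p hp⟩
  have hrp := hr.contDiffAt (hU.mem_nhds hp)
  refine ⟨fun x => if hx : r x ∈ S then f ⟨r x, hx⟩ else 0, ?_, fun x hx => dif_pos (hrS x hx)⟩
  refine (hk'.comp p hrp).congr_of_eventuallyEq ?_
  filter_upwards [hU.mem_nhds hp, hrp.continuousAt.preimage_mem_nhds (hV.mem_nhds hpV)]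
    with x hx hxV
  rw [dif_pos (hrS x hx), Function.comp_apply]
  exact h ⟨r x, hrS x hx⟩ hxV

/-- Picard–Lindelöf with existence time `a / L`, independent of `t₁`. The curve is extended by
constants outside the interval, so it is continuous and in the ball for all times, and only the
derivative is local. -/
theorem exists_hasDerivWithinAt_Icc_mem_closedBall {E : Type*} [NormedAddCommGroup E]
    [NormedSpace ℝ E] [CompleteSpace E] {f : ℝ → E → E} (t₁ : ℝ) (q : E) {a L : ℝ} {K : NNReal}
    (ha : 0 ≤ a) (hL : 0 < L) (hf : ∀ t, LipschitzOnWith K (f t) (Metric.closedBall q a))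
    (hfc : ∀ x ∈ Metric.closedBall q a, Continuous fun t => f t x)
    (hfL : ∀ t, ∀ x ∈ Metric.closedBall q a, ‖f t x‖ ≤ L) :
    ∃ α : ℝ → E, α t₁ = q ∧ Continuous α ∧ (∀ t, α t ∈ Metric.closedBall q a) ∧
      ∀ t ∈ Icc t₁ (t₁ + a / L), HasDerivWithinAt α (f t (α t)) (Icc t₁ (t₁ + a / L)) t := by
  lift a to NNReal using ha
  lift L to NNReal using hL.le
  have hε0 : 0 ≤ (a : ℝ) / L := by positivity
  have ht₁ : t₁ ∈ Icc t₁ (t₁ + a / L) := ⟨le_rfl, by linarith⟩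
  have hPL : IsPicardLindelof f ⟨t₁, ht₁⟩ q a 0 L K :=
    { lipschitzOnWith := fun t _ => hf t
      continuousOn := fun x hx => (hfc x hx).continuousOn
      norm_le := fun t _ x hx => hfL t x hx
      mul_max_le := by
        simp only [sub_self, add_sub_cancel_left, sup_of_le_left hε0, NNReal.coe_zero, sub_zero]
        rw [mul_div_cancel₀ _ hL.ne'] }
  obtain ⟨α, hα⟩ := ODE.FunSpace.exists_isFixedPt_next hPL (Metric.mem_closedBall_self le_rfl)
  refine ⟨α.compProj, ?_, α.continuous_compProj,
    fun t => α.compProj_mem_closedBall hPL.mul_max_le, fun t ht => ?_⟩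
  · rw [ODE.FunSpace.compProj_of_mem ht₁, ← hα, ODE.FunSpace.next_apply₀]
  · refine (ODE.hasDerivWithinAt_picard_Icc ht₁ hPL.continuousOn_uncurry
      α.continuous_compProj.continuousOn (fun _ _ => α.compProj_mem_closedBall hPL.mul_max_le) q
      ht).congr_of_mem (fun s hs => ?_) ht
    rw [ODE.FunSpace.compProj_of_mem hs]
    conv_lhs => rw [← hα]
    rw [ODE.FunSpace.next_apply]

/-- The fields are extended off `M` as `X k ∘ r` and the ambient equation is solved. Tangency of the
fields forces `α - r ∘ α` to satisfy a linear differential inequality with zero initial value, so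
`α` never leaves `M`. -/
theorem exists_isSolutionOn_Icc_nhds [CompleteSpace F] (hM : IsLocalSmoothRetract M)
    {g : ι → ℝ → ℝ} (hg : ∀ k, Continuous (g k)) {B : ℝ} (hB : ∀ k t, |g k t| ≤ B)
    {X : ι → M → F} (hX : ∀ k, IsSmooth (X k)) (hXM : ∀ k (x : M), X k x ∈ velocitySpan M (x : F)) (p : M) :
    ∃ ρ > 0, ∃ ε > 0, ∀ t₁ : ℝ, ∀ q : M, dist q p < ρ → ∃ y : ℝ → M,
      IsSolutionOn (modulatedField g X) (Icc t₁ (t₁ + ε)) y ∧ y t₁ = q := by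
  classical
  obtain ⟨U, r, hU, hpU, hr, hrM, hrM'⟩ := hM p p.2
  choose H hHs hH using fun k => (hX k).exists_comp_retraction hU hr hrM hpU
  choose κ s hs hκ using fun k =>
    ((hHs k).of_le (m := 1) (by exact_mod_cast le_top)).exists_lipschitzOnWith
  have hr' : ContDiffAt ℝ 1 (fderiv ℝ r) p :=
    ((hr.contDiffAt (hU.mem_nhds hpU)).of_le (m := 2) (WithTop.coe_le_coe.2 (le_top : (2 : ℕ∞) ≤ ⊤))).fderiv_right
      one_add_one_eq_two.le
  obtain ⟨κ', s', hs', hκ'⟩ := hr'.exists_lipschitzOnWith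
  have hrc : ContinuousAt r p := hr.continuousOn.continuousAt (hU.mem_nhds hpU)
  have hrp : r p = p := hrM' p hpU p.2
  -- The conditions on `r x` as well as on `x` are what allow comparing the derivative of `r` at
  -- these two points.
  have hN : ∀ᶠ x in 𝓝 (p : F), (∀ k, x ∈ s k ∧ ‖H k x‖ ≤ ‖H k p‖ + 1) ∧ (x ∈ U ∧ x ∈ s') ∧
      (r x ∈ U ∧ r x ∈ s') := by
    refine ((Filter.eventually_all.2 fun k => Filter.Eventually.and (hs k) ?_).and
      ((Filter.Eventually.and (hU.mem_nhds hpU) hs').and ?_))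
    · exact (hHs k).continuousAt.norm.eventually_le_const (lt_add_one _)
    · have : U ∩ s' ∈ 𝓝 (r p) := by rw [hrp]; exact Filter.inter_mem (hU.mem_nhds hpU) hs'
      exact hrc.preimage_mem_nhds this
  obtain ⟨a, ha, haN⟩ := Metric.eventually_nhds_iff_ball.1 hN
  have hB0 : ∀ k, 0 ≤ B := fun k => (abs_nonneg _).trans (hB k 0)
  set f : ℝ → F → F := fun t x => ∑ k, g k t • H k x with hf
  set L : ℝ := 1 + ∑ k, |B| * (‖H k p‖ + 1) with hL
  have hL0 : 0 < L := by positivity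
  have hfL : ∀ t, ∀ x ∈ Metric.ball (p : F) a, ‖f t x‖ ≤ L := by
    intro t x hx
    refine (norm_sum_le_of_le _ (n := fun k => |B| * (‖H k p‖ + 1)) fun k _ => ?_).trans
      (by linarith)
    rw [norm_smul, Real.norm_eq_abs]
    exact mul_le_mul ((hB k t).trans (le_abs_self _)) ((haN x hx).1 k).2
      (norm_nonneg _) (abs_nonneg _)
  set K : NNReal := ∑ k, ‖B‖₊ * κ k
  have hfK : ∀ t, LipschitzOnWith K (f t) (Metric.ball (p : F) a) := by
    intro t
    refine LipschitzOnWith.of_dist_le_mul fun x hx y hy => ?_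
    rw [dist_eq_norm, hf]
    simp only [← Finset.sum_sub_distrib, K, NNReal.coe_sum, Finset.sum_mul]
    refine norm_sum_le_of_le _ fun k _ => ?_
    have := (hκ k).dist_le_mul x ((haN x hx).1 k).1 y ((haN y hy).1 k).1
    rw [dist_eq_norm] at this
    rw [← smul_sub, norm_smul, NNReal.coe_mul, coe_nnnorm, mul_assoc, Real.norm_eq_abs,
      Real.norm_eq_abs]
    exact mul_le_mul ((hB k t).trans (le_abs_self _)) this (norm_nonneg _) (abs_nonneg _)
  -- A ball of radius `a / 4` around a point within `a / 2` of `p` stays in the good ball, so one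
  -- existence time serves all these initial points.
  refine ⟨a / 2, half_pos ha, a / 4 / L, by positivity, fun t₁ q hq => ?_⟩
  have hball : Metric.closedBall (q : F) (a / 4) ⊆ Metric.ball (p : F) a := by
    intro x hx
    have h1 : dist x q ≤ a / 4 := hx
    have h2 : dist (q : F) p < a / 2 := hq
    exact Metric.mem_ball.2 (by linarith [dist_triangle x q p])
  obtain ⟨α, hα1, hαc, hαq, hαd⟩ := exists_hasDerivWithinAt_Icc_mem_closedBall (f := f) t₁ (q : F)
    (a := a / 4) (by positivity) hL0 (fun t => (hfK t).mono hball)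
    (fun x _ => by exact continuous_finsetSum _ fun k _ => (hg k).smul continuous_const)
    (fun t x hx => hfL t x (hball hx))
  set ε := a / 4 / L with hε
  have hε0 : 0 < ε := by positivity
  have hαball : ∀ t, α t ∈ Metric.ball (p : F) a := fun t => hball (hαq t)
  have hfr : ∀ t x (hx : x ∈ U), f t x = modulatedField g X t ⟨r x, hrM x hx⟩ := by
    intro t x hx
    simp only [hf, modulatedField, hH _ x hx]
  have hαU : ∀ t, α t ∈ U := fun t => (haN _ (hαball t)).2.1.1
  have hrd : ∀ x ∈ U, HasFDerivAt r (fderiv ℝ r x) x := fun x hx =>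
    ((hr.contDiffAt (hU.mem_nhds hx)).differentiableAt (by simp)).hasFDerivAt
  have hfix : ∀ t ∈ Icc t₁ (t₁ + ε), α t - r (α t) = 0 := by
    refine eq_zero_of_abs_deriv_le_mul_abs_self_of_eq_zero_right
      (f' := fun t => f t (α t) - fderiv ℝ r (α t) (f t (α t))) (K := κ' * L)
      (fun t ht => ?_) (fun t ht => ?_) ?_ fun t ht => ?_
    · exact hαc.continuousWithinAt.sub
        ((hrd _ (hαU t)).continuousAt.comp hαc.continuousAt).continuousWithinAt
    · have h1 := (hαd t ⟨ht.1, ht.2.le⟩).mono_of_mem_nhdsWithin (Icc_mem_nhdsGE_of_mem ht)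
      exact h1.sub ((hrd _ (hαU t)).comp_hasDerivWithinAt t h1)
    · rw [hα1, hrM' q (hα1 ▸ hαU t₁) q.2, sub_self]
    · have hx := haN _ (hαball t)
      have hv : f t (α t) ∈ velocitySpan M (r (α t)) := by
        rw [hfr t _ (hαU t)]
        unfold modulatedField
        exact Submodule.sum_mem _ fun k _ =>
          Submodule.smul_mem _ _ (hXM k ⟨r (α t), hrM _ (hαU t)⟩)
      have e1 := fderiv_retraction_apply hU hr hrM' hx.2.2.1 (hrM _ (hαU t)) hv
      -- The extended field at `α t` is tangent to `M` at `r (α t)`, hence fixed by the derivative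
      -- of `r` there. The defect is thus a difference of derivatives at `r (α t)` and `α t`, at
      -- most `κ' ‖α t - r (α t)‖` times the speed `L`.
      have e2 : f t (α t) - fderiv ℝ r (α t) (f t (α t)) =
          (fderiv ℝ r (r (α t)) - fderiv ℝ r (α t)) (f t (α t)) := by
        rw [sub_apply, e1]
      rw [e2]
      refine (ContinuousLinearMap.le_opNorm _ _).trans ?_
      have h3 := hκ'.dist_le_mul _ hx.2.2.2 _ hx.2.1.2
      rw [dist_eq_norm, dist_eq_norm] at h3
      rw [norm_sub_rev (α t)]
      refine (mul_le_mul h3 (hfL t _ (hαball t)) (norm_nonneg _) (by positivity)).trans_eq ?_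
      ring
  refine ⟨fun t => ⟨r (α t), hrM _ (hαU t)⟩, ⟨ordConnected_Icc, fun t ht s hs => ?_⟩, ?_⟩
  · have hfc : ContinuousOn (fun t => f t (α t)) (Icc t₁ (t₁ + ε)) :=
      continuousOn_finsetSum _ fun k _ => (hg k).continuousOn.smul fun t _ =>
        (((hκ k).continuousOn.mono fun x hx => ((haN x hx).1 k).1).continuousAt
          (Metric.isOpen_ball.mem_nhds (hαball t))).comp_continuousWithinAt
            hαc.continuousWithinAt
    have hsub : uIcc t s ⊆ Icc t₁ (t₁ + ε) := uIcc_subset_Icc ht hs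
    simp only [← hfr _ _ (hαU _)]
    refine ⟨(hfc.mono hsub).intervalIntegrable, ?_⟩
    have := intervalIntegral.integral_eq_sub_of_hasDeriv_right (hαc.continuousOn (s := uIcc t s))
      (f' := fun t => f t (α t)) (fun τ hτ => ?_) (hfc.mono hsub).intervalIntegrable
    · rw [this, ← sub_eq_zero.1 (hfix t ht), ← sub_eq_zero.1 (hfix s hs)]
      abel
    · have hτ' : τ ∈ Icc t₁ (t₁ + ε) := hsub (Ioo_subset_Icc_self hτ)
      refine (hαd τ hτ').mono_of_mem_nhdsWithin
        (Filter.mem_of_superset (Ioo_mem_nhdsGT hτ.2) fun σ hσ => hsub ?_)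
      exact ⟨hτ.1.le.trans hσ.1.le, hσ.2.le⟩
  · refine Subtype.ext ?_
    exact (sub_eq_zero.1 (hfix t₁ ⟨le_rfl, by linarith⟩)).symm.trans hα1

/-- Compactness makes the local existence time uniform over `K`; this is the continuation criterion
for maximal solutions. -/
theorem exists_isSolutionOn_Icc_of_isCompact [CompleteSpace F] (hM : IsLocalSmoothRetract M)
    {g : ι → ℝ → ℝ} (hg : ∀ k, Continuous (g k)) {B : ℝ} (hB : ∀ k t, |g k t| ≤ B)
    {X : ι → M → F} (hX : ∀ k, IsSmooth (X k)) (hXM : ∀ k (x : M), X k x ∈ velocitySpan M (x : F))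
    {K : Set M} (hK : IsCompact K) :
    ∃ ε > 0, ∀ t₁ : ℝ, ∀ q ∈ K, ∃ y : ℝ → M,
      IsSolutionOn (modulatedField g X) (Icc t₁ (t₁ + ε)) y ∧ y t₁ = q := by
  refine hK.induction_on (p := fun K => ∃ ε > 0, ∀ t₁ : ℝ, ∀ q ∈ K, ∃ y : ℝ → M,
    IsSolutionOn (modulatedField g X) (Icc t₁ (t₁ + ε)) y ∧ y t₁ = q) ?_ ?_ ?_ ?_
  · exact ⟨1, one_pos, fun _ _ h => h.elim⟩
  · intro s t hst h
    obtain ⟨ε, hε, h⟩ := h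
    exact ⟨ε, hε, fun t₁ q hq => h t₁ q (hst hq)⟩
  · intro s t hs ht
    obtain ⟨ε, hε, h⟩ := hs
    obtain ⟨ε', hε', h'⟩ := ht
    refine ⟨min ε ε', lt_min hε hε', fun t₁ q hq => ?_⟩
    rcases hq with hq | hq
    · obtain ⟨y, hy, hyq⟩ := h t₁ q hq
      exact ⟨y, hy.mono ordConnected_Icc (Icc_subset_Icc le_rfl (by gcongr; exact min_le_left _ _)),
        hyq⟩
    · obtain ⟨y, hy, hyq⟩ := h' t₁ q hq
      exact ⟨y, hy.mono ordConnected_Icc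
        (Icc_subset_Icc le_rfl (by gcongr; exact min_le_right _ _)), hyq⟩
  · intro p hp
    obtain ⟨ρ, hρ, ε, hε, h⟩ := exists_isSolutionOn_Icc_nhds hM hg hB hX hXM p
    exact ⟨Metric.ball p ρ, mem_nhdsWithin_of_mem_nhds (Metric.ball_mem_nhds p hρ), ε, hε,
      fun t₁ q hq => h t₁ q hq⟩

end Modulated

/-! ## Averaging -/

section Averaging

variable {F : Type*} [NormedAddCommGroup F] [NormedSpace ℝ F] [CompleteSpace F] {M : Set F}
  {ι : Type*} [Fintype ι]

/-- Integrals against a rapidly oscillating periodic function of mean zero are small. -/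
theorem exists_norm_integral_oscillating_le {g : ℝ → ℝ} {m T : ℝ} (hT : 0 < T) (hg : Continuous g)
    (hper : Function.Periodic g T) (hmean : ∫ τ in (0 : ℝ)..T, g τ = T * m) :
    ∃ D : ℝ, 0 ≤ D ∧ ∀ (ω a b : ℝ) (c c' : ℝ → F) (C₀ C₁ : ℝ), 0 < ω → a ≤ b →
      (∀ t ∈ Icc a b, HasDerivWithinAt c (c' t) (Icc a b) t) → ContinuousOn c' (Icc a b) →
      (∀ t ∈ Icc a b, ‖c t‖ ≤ C₀) → (∀ t ∈ Ioo a b, ‖c' t‖ ≤ C₁) →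
      ‖∫ s in a..b, (g (ω * s) - m) • c s‖ ≤ D / ω * (2 * C₀ + C₁ * (b - a)) := by
  -- Removing the mean makes this primitive periodic, hence bounded by some `D`. Then `G (ω t) / ω`
  -- is a primitive of the oscillating factor of size `D / ω`, and integration by parts transfers
  -- the derivative to `c`.
  set G : ℝ → ℝ := fun τ => ∫ s in (0 : ℝ)..τ, (g s - m) with hG
  have hgm : Continuous fun s => g s - m := hg.sub continuous_const
  have hGd : ∀ τ, HasDerivAt G (g τ - m) τ := fun τ =>
    intervalIntegral.integral_hasDerivAt_right (hgm.intervalIntegrable _ _)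
      (hgm.stronglyMeasurableAtFilter _ _) hgm.continuousAt
  have hGc : Continuous G := continuous_iff_continuousAt.2 fun τ => (hGd τ).continuousAt
  have hGper : Function.Periodic G T := by
    intro τ
    have hp : Function.Periodic (fun s => g s - m) T := fun s => by simp only [hper s]
    have h1 : ∫ s in τ..(τ + T), (g s - m) = 0 := by
      rw [hp.intervalIntegral_add_eq τ 0, zero_add,
        intervalIntegral.integral_sub (hg.intervalIntegrable _ _) (by simp), hmean]
      simp
    simp only [hG]
    rw [← intervalIntegral.integral_add_adjacent_intervals (hgm.intervalIntegrable 0 τ)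
      (hgm.intervalIntegrable τ (τ + T)), h1, add_zero]
  obtain ⟨D, hD⟩ := isBounded_iff_forall_norm_le.1 (hGper.isBounded_of_continuous hT.ne' hGc)
  have hD' : ∀ τ, |G τ| ≤ D := fun τ => hD _ (mem_range_self τ)
  have hD0 : 0 ≤ D := (abs_nonneg _).trans (hD' 0)
  refine ⟨D, hD0, fun ω a b c c' C₀ C₁ hω hab hc hc' hC₀ hC₁ => ?_⟩
  have hgω : Continuous fun s => g (ω * s) - m := by fun_prop
  have hGω : ∀ t, HasDerivAt (fun t => G (ω * t) / ω) (g (ω * t) - m) t := by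
    intro t
    have h1 : HasDerivAt (fun t : ℝ => ω * t) ω t := by
      simpa using (hasDerivAt_id t).const_mul ω
    have := ((hGd (ω * t)).comp t h1).div_const ω
    rwa [mul_div_cancel_right₀ _ hω.ne'] at this
  have key := integral_smul_add_smul_eq_sub (g := fun s => g (ω * s) - m)
    (G := fun t => G (ω * t) / ω) (c := c) (c' := c') (a := a) (b := b)
    (hgω.intervalIntegrable _ _) (fun t _ => by
      rw [intervalIntegral.integral_eq_sub_of_hasDerivAt (fun s _ => hGω s)
        (hgω.intervalIntegrable _ _)]
      ring) (by rwa [uIcc_of_le hab]) (by rwa [uIcc_of_le hab])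
  have hcc : ContinuousOn c (Icc a b) := fun t ht => (hc t ht).continuousWithinAt
  have hGωb : ∀ t, |G (ω * t) / ω| ≤ D / ω := fun t => by
    rw [abs_div, abs_of_pos hω]
    exact div_le_div_of_nonneg_right (hD' _) hω.le
  have i1 : IntervalIntegrable (fun s => (g (ω * s) - m) • c s) volume a b :=
    ContinuousOn.intervalIntegrable (by
      rw [uIcc_of_le hab]; exact hgω.continuousOn.smul hcc)
  have i2 : IntervalIntegrable (fun s => (G (ω * s) / ω) • c' s) volume a b :=
    ContinuousOn.intervalIntegrable (by
      rw [uIcc_of_le hab]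
      exact (continuous_iff_continuousAt.2 fun t => (hGω t).continuousAt).continuousOn.smul hc')
  have e := key.2
  rw [intervalIntegral.integral_add i1 i2] at e
  have e' := eq_sub_of_add_eq e
  have n1 : ∀ t ∈ Icc a b, ‖(G (ω * t) / ω) • c t‖ ≤ D / ω * C₀ := fun t ht => by
    rw [norm_smul, Real.norm_eq_abs]
    exact mul_le_mul (hGωb t) (hC₀ t ht) (norm_nonneg _) (by positivity)
  have n2 : ‖∫ s in a..b, (G (ω * s) / ω) • c' s‖ ≤ D / ω * C₁ * |b - a| := by
    refine intervalIntegral.norm_integral_le_of_norm_le_const_ae ?_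
    filter_upwards [Measure.ae_ne volume b] with t htb ht
    rw [uIoc_of_le hab] at ht
    rw [norm_smul, Real.norm_eq_abs]
    exact mul_le_mul (hGωb t) (hC₁ t ⟨ht.1, lt_of_le_of_ne ht.2 htb⟩) (norm_nonneg _)
      (by positivity)
  rw [e']
  refine (norm_sub_le _ _).trans ((add_le_add (norm_sub_le _ _) le_rfl).trans ?_)
  have := n1 a (left_mem_Icc.2 hab)
  have := n1 b (right_mem_Icc.2 hab)
  rw [abs_of_nonneg (sub_nonneg.2 hab)] at n2
  linarith

/-- The difference splits into the oscillating field evaluated on `x` versus `xbar`, controlled by a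
Lipschitz constant, and the oscillating field minus its mean along `xbar`, which is `O(1/ω)` by the
preceding estimate. Grönwall combines the two with a constant independent of `ω`, `t₀` and the
solutions. -/
theorem exists_norm_sub_le_of_averaging {T : ℝ} (hT : 0 < T) {g : ι → ℝ → ℝ} {m : ι → ℝ}
    (hg : ∀ k, Continuous (g k)) (hper : ∀ k, Function.Periodic (g k) T)
    (hmean : ∀ k, ∫ τ in (0 : ℝ)..T, g k τ = T * m k) {X : ι → M → F} (hX : ∀ k, IsSmooth (X k))
    {K : Set M} (hK : IsCompact K) (Δ : ℝ) :
    ∃ E : ℝ, 0 ≤ E ∧ ∀ (ω t₀ b : ℝ) (x xbar : ℝ → M), 0 < ω → t₀ ≤ b → b ≤ t₀ + Δ →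
      IsSolutionOn (modulatedField (fun k t => g k (ω * t)) X) (Icc t₀ b) x →
      IsSolutionOn (modulatedField (fun k _ => m k) X) (Icc t₀ b) xbar → x t₀ = xbar t₀ →
      (∀ t ∈ Icc t₀ b, x t ∈ K ∧ xbar t ∈ K) → ‖(x b : F) - xbar b‖ ≤ E / ω := by
  choose B hB using fun k => isBounded_iff_forall_norm_le.1
    ((hper k).isBounded_of_continuous hT.ne' (hg k))
  have hB' : ∀ k τ, |g k τ| ≤ B k := fun k τ => hB k _ (mem_range_self τ)
  obtain ⟨L, hL, hLip⟩ := exists_norm_modulatedField_sub_le (fun k => (hX k).locallyLipschitz) hK B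
  obtain ⟨V, hV0, hV⟩ := exists_norm_modulatedField_le (fun k => (hX k).continuous) hK
    (fun k => |m k|)
  choose D hD0 hD using fun k =>
    exists_norm_integral_oscillating_le (F := F) hT (hg k) (hper k) (hmean k)
  choose C hC using fun k => hK.exists_bound_of_continuousOn (hX k).continuous.continuousOn
  choose ℓ hℓ using fun k =>
    ((hX k).locallyLipschitz.locallyLipschitzOn (s := K)).exists_lipschitzOnWith_of_compact hK
  refine ⟨(∑ k, D k * (2 * |C k| + ℓ k * V * |Δ|)) * Real.exp (L * |Δ|), ?_,
    fun ω t₀ b x xbar hω htb hbΔ hx hxbar h0 hmem => ?_⟩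
  · exact mul_nonneg (Finset.sum_nonneg fun k _ => mul_nonneg (hD0 k) (by positivity))
      (Real.exp_nonneg _)
  rcases htb.eq_or_lt with rfl | htb'
  · rw [h0, sub_self, norm_zero]
    exact div_nonneg (mul_nonneg (Finset.sum_nonneg fun k _ => mul_nonneg (hD0 k) (by positivity))
      (Real.exp_nonneg _)) hω.le
  have hΔ : 0 < Δ := by linarith
  have hxc := hx.continuousOn
  have hxbc := hxbar.continuousOn
  have hgω : ∀ k, Continuous fun t => g k (ω * t) := fun k => (hg k).comp (by fun_prop)
  have hVc := continuousOn_modulatedField (g := fun k _ => m k) (fun k => continuous_const)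
    (fun k => (hX k).continuous) hxbc
  have hxd : ∀ t ∈ Icc t₀ b, HasDerivWithinAt (fun t => (xbar t : F))
      (modulatedField (fun k _ => m k) X t (xbar t)) (Icc t₀ b) t := fun t ht =>
    hasDerivWithinAt_of_eq_add_integral ordConnected_Icc hVc
      (fun s hs t ht => (hxbar.2 s hs t ht).2) ht
  have hxlip : ∀ s ∈ Icc t₀ b, ∀ t ∈ Icc t₀ b, ‖(xbar t : F) - xbar s‖ ≤ V * |t - s| := by
    intro s hs t ht
    rw [(hxbar.2 s hs t ht).2, add_sub_cancel_left]
    refine intervalIntegral.norm_integral_le_of_norm_le_const fun τ hτ => ?_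
    exact hV _ _ (fun k => le_rfl) _
      (hmem τ (uIcc_subset_Icc hs ht (uIoc_subset_uIcc hτ))).2
  have hosc : ∀ k, ∀ t ∈ Icc t₀ b, ‖∫ s in t₀..t, (g k (ω * s) - m k) • X k (xbar s)‖ ≤
      D k * (2 * |C k| + ℓ k * V * |Δ|) / ω := by
    intro k t ht
    obtain ⟨c', hc'c, hc'⟩ := (hX k).exists_hasDerivWithinAt hxd hVc (uniqueDiffOn_Icc htb')
    have hsub : Icc t₀ t ⊆ Icc t₀ b := Icc_subset_Icc le_rfl ht.2
    refine (hD k ω t₀ t (fun s => X k (xbar s)) c' |C k| (ℓ k * V) hω ht.1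
      (fun s hs => (hc' s (hsub hs)).mono hsub) (hc'c.mono hsub)
      (fun s hs => (hC k _ (hmem s (hsub hs)).2).trans (le_abs_self _)) fun s hs => ?_).trans ?_
    -- The derivative of `X k ∘ xbar` is bounded at interior points by the Lipschitz constant of `X
    -- k` on `K` times the speed bound `V` of `xbar`.
    · have hn : Icc t₀ t ∈ 𝓝 s := Icc_mem_nhds hs.1 hs.2
      have hd := ((hc' s (hsub (Ioo_subset_Icc_self hs))).mono hsub).hasDerivAt hn
      refine hd.le_of_lip' (by positivity) ?_
      filter_upwards [hn] with σ hσ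
      have h1 := (hℓ k).dist_le_mul _ (hmem σ (hsub hσ)).2 _
        (hmem s (hsub (Ioo_subset_Icc_self hs))).2
      rw [dist_eq_norm, Subtype.dist_eq, dist_eq_norm] at h1
      rw [mul_assoc]
      exact h1.trans (mul_le_mul_of_nonneg_left
        (hxlip s (hsub (Ioo_subset_Icc_self hs)) σ (hsub hσ)) (by positivity))
    · rw [div_mul_eq_mul_div]
      have : t - t₀ ≤ |Δ| := by rw [abs_of_pos hΔ]; linarith [ht.2]
      have := hD0 k
      gcongr
  set S := ∑ k, D k * (2 * |C k| + ℓ k * V * |Δ|) with hS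
  have hS0 : 0 ≤ S := Finset.sum_nonneg fun k _ => mul_nonneg (hD0 k) (by positivity)
  have hzc : ContinuousOn (fun s => ‖(x s : F) - xbar s‖) (Icc t₀ b) :=
    (hx.continuousOn_coe.sub hxbar.continuousOn_coe).norm
  have hgr := le_mul_exp_of_le_add_integral (ε := S / ω) hzc hL (fun t ht => ?_) b
    (right_mem_Icc.2 htb)
  · refine hgr.trans ?_
    rw [div_mul_eq_mul_div]
    have : b - t₀ ≤ |Δ| := by rw [abs_of_pos hΔ]; linarith
    gcongr
  · have ht₀ : t₀ ∈ Icc t₀ b := left_mem_Icc.2 htb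
    have hsub : Icc t₀ t ⊆ Icc t₀ b := Icc_subset_Icc le_rfl ht.2
    obtain ⟨i1, e1⟩ := hx.2 t₀ ht₀ t ht
    obtain ⟨i2, e2⟩ := hxbar.2 t₀ ht₀ t ht
    have hfc := (continuousOn_modulatedField hgω (fun k => (hX k).continuous) hxbc).mono hsub
    have i3 : IntervalIntegrable
        (fun s => modulatedField (fun k t => g k (ω * t)) X s (xbar s)) volume t₀ t :=
      hfc.intervalIntegrable_of_Icc ht.1
    have hXc : ∀ k, ContinuousOn (fun s => X k (xbar s)) (Icc t₀ t) := fun k =>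
      ((hX k).continuous.comp_continuousOn hxbc).mono hsub
    have e3 : (x t : F) - xbar t =
        (∫ s in t₀..t, (modulatedField (fun k t => g k (ω * t)) X s (x s) -
          modulatedField (fun k t => g k (ω * t)) X s (xbar s))) +
        ∑ k, ∫ s in t₀..t, (g k (ω * s) - m k) • X k (xbar s) := by
      have i4 : ∀ k, IntervalIntegrable (fun s => (g k (ω * s) - m k) • X k (xbar s)) volume t₀ t :=
        fun k => ContinuousOn.intervalIntegrable_of_Icc ht.1
          (((hgω k).sub continuous_const).continuousOn.smul (hXc k))
      have hs : ∑ k, ∫ s in t₀..t, (g k (ω * s) - m k) • X k (xbar s) =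
          (∫ s in t₀..t, modulatedField (fun k t => g k (ω * t)) X s (xbar s)) -
            ∫ s in t₀..t, modulatedField (fun k _ => m k) X s (xbar s) := by
        rw [← intervalIntegral.integral_finsetSum fun k _ => i4 k,
          ← intervalIntegral.integral_sub i3 i2]
        simp only [modulatedField, sub_smul, Finset.sum_sub_distrib]
      rw [hs, e1, e2, h0, intervalIntegral.integral_sub i1 i3]
      abel
    rw [e3]
    refine (norm_add_le _ _).trans ((add_comm _ _).trans_le (add_le_add ?_ ?_))
    · refine (norm_sum_le_of_le _ fun k _ => hosc k t ht).trans_eq ?_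
      rw [hS, Finset.sum_div]
    · rw [← intervalIntegral.integral_const_mul]
      refine intervalIntegral.norm_integral_le_of_norm_le ht.1 (.of_forall fun τ hτ => ?_)
        ((hzc.mono hsub).intervalIntegrable_of_Icc ht.1 |>.const_mul _)
      have hτ' := hmem τ (hsub (Ioc_subset_Icc_self hτ))
      exact hLip (fun k t => g k (ω * t)) τ (fun k => hB' k _) _ hτ'.1 _ hτ'.2

/-- The averaging theorem for periodic systems on a local smooth retract. -/
theorem exists_forall_norm_sub_le_of_averaging [LocallyCompactSpace F]
    (hM : IsLocalSmoothRetract M) {T : ℝ} (hT : 0 < T)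
    {g : ι → ℝ → ℝ} {m : ι → ℝ} (hg : ∀ k, Continuous (g k))
    (hper : ∀ k, Function.Periodic (g k) T)
    (hmean : ∀ k, ∫ τ in (0 : ℝ)..T, g k τ = T * m k) {X : ι → M → F} (hX : ∀ k, IsSmooth (X k))
    (hXM : ∀ k (x : M), X k x ∈ velocitySpan M (x : F))
    {C : Set M} (hC : IsCompact C) {ν Δ : ℝ} (hν : 0 < ν) (hΔ : 0 < Δ) :
    ∃ ω₀ > 0, ∀ (t₀ : ℝ) (J : Set ℝ) (xbar : ℝ → M),
      IsSolutionOn (modulatedField (fun k _ => m k) X) J xbar →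
      (∀ t ∈ Icc t₀ (t₀ + Δ), t ∈ J ∧ xbar t ∈ C) →
      ∀ ω ≥ ω₀, ∀ (I : Set ℝ) (x : ℝ → M),
        IsMaximalSolution (modulatedField (fun k t => g k (ω * t)) X) t₀ (xbar t₀) I x →
        ∀ t ∈ Icc t₀ (t₀ + Δ), t ∈ I ∧ ‖(x t : F) - xbar t‖ ≤ ν := by
  have : LocallyCompactSpace M := hM.isLocallyClosed.locallyCompactSpace
  obtain ⟨δ, hδ, hK⟩ := hC.exists_isCompact_cthickening
  set K := Metric.cthickening δ C
  obtain ⟨E, hE, hest⟩ := exists_norm_sub_le_of_averaging hT hg hper hmean hX hK Δ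
  set δ' := min ν δ with hδ'
  have hδ'0 : 0 < δ' := lt_min hν hδ
  -- The extra `1` makes `E / ω < δ'` strict and the threshold positive even when `E = 0`.
  refine ⟨(E + 1) / δ', by positivity, fun t₀ J xbar hxbar hmem ω hω I x hx => ?_⟩
  have hω0 : 0 < ω := lt_of_lt_of_le (by positivity) hω
  have hEω : E / ω < δ' := by
    rw [div_lt_iff₀ hω0]
    have := (div_le_iff₀ hδ'0).1 hω
    linarith
  have hxI := hx.2.2.1
  have h0 : x t₀ = xbar t₀ := hx.2.1
  -- the a priori estimate
  have hlt : ∀ b ∈ I, b ∈ Icc t₀ (t₀ + Δ) → ∀ t ∈ Icc t₀ b, ‖(x t : F) - xbar t‖ < δ' := by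
    intro b hbI hb
    have hsubI : Icc t₀ b ⊆ I := hxI.1.out hx.1 hbI
    have hsubΔ : Icc t₀ b ⊆ Icc t₀ (t₀ + Δ) := Icc_subset_Icc le_rfl hb.2
    have hsubJ : Icc t₀ b ⊆ J := fun t ht => (hmem t (hsubΔ ht)).1
    have hzc : ContinuousOn (fun s => ‖(x s : F) - xbar s‖) (Icc t₀ b) :=
      ((hxI.continuousOn_coe.mono hsubI).sub (hxbar.continuousOn_coe.mono hsubJ)).norm
    have hivt : ∀ s ∈ Icc t₀ b, δ' ≤ ‖(x s : F) - xbar s‖ →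
        ∃ s' ∈ Icc t₀ s, ‖(x s' : F) - xbar s'‖ = δ' := fun s hs hle =>
      intermediate_value_Icc hs.1 (hzc.mono (Icc_subset_Icc le_rfl hs.2))
        ⟨by simpa [h0] using hδ'0.le, hle⟩
    by_contra! hcon
    obtain ⟨t, ht, hle⟩ := hcon
    have hAc : IsCompact (Icc t₀ b ∩ (fun s => ‖(x s : F) - xbar s‖) ⁻¹' {δ'}) :=
      isCompact_Icc.of_isClosed_subset
        (hzc.preimage_isClosed_of_isClosed isClosed_Icc isClosed_singleton) inter_subset_left
    obtain ⟨t', ht', htδ⟩ := hivt t ht hle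
    -- At the first time the distance equals `δ'`, the solution has so far stayed in the thickening
    -- `K`; the averaging estimate then gives a distance below `δ'` at that very time, a
    -- contradiction.
    obtain ⟨t₁, ht₁, hmin⟩ := hAc.exists_isLeast ⟨t', ⟨ht'.1, ht'.2.trans ht.2⟩, htδ⟩
    have hsub1 : Icc t₀ t₁ ⊆ Icc t₀ b := Icc_subset_Icc le_rfl ht₁.1.2
    have hz1 : ∀ s ∈ Icc t₀ t₁, ‖(x s : F) - xbar s‖ ≤ δ' := by
      intro s hs
      by_contra! hlt
      obtain ⟨s', hs', hsδ⟩ := hivt s (hsub1 hs) hlt.le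
      have hst : s' = s := le_antisymm hs'.2
        (hs.2.trans (hmin ⟨⟨hs'.1, hs'.2.trans (hsub1 hs).2⟩, hsδ⟩))
      rw [← hst, hsδ] at hlt
      exact lt_irrefl _ hlt
    have := hest ω t₀ t₁ x xbar hω0 ht₁.1.1 (hsubΔ ht₁.1).2
      (hxI.mono ordConnected_Icc (hsub1.trans hsubI))
      (hxbar.mono ordConnected_Icc (hsub1.trans hsubJ)) h0 fun s hs => ?_
    · exact absurd (this.trans_lt hEω) (not_lt.2 (ge_of_eq ht₁.2))
    · have hsC := (hmem s (hsubΔ (hsub1 hs))).2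
      refine ⟨Metric.mem_cthickening_of_dist_le (x s) (xbar s) δ C hsC ?_,
        Metric.self_subset_cthickening C hsC⟩
      rw [Subtype.dist_eq, dist_eq_norm]
      exact (hz1 s hs).trans (min_le_right _ _)
  have hgω : ∀ k, Continuous fun t => g k (ω * t) := fun k => (hg k).comp (by fun_prop)
  choose B hB using fun k => isBounded_iff_forall_norm_le.1
    ((hper k).isBounded_of_continuous hT.ne' (hg k))
  have hB' : ∀ k t, |g k (ω * t)| ≤ ∑ k, |B k| := fun k τ =>
    ((hB k _ (mem_range_self (ω * τ))).trans (le_abs_self _)).trans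
      (Finset.single_le_sum (f := fun k => |B k|) (fun k _ => abs_nonneg _) (Finset.mem_univ k))
  obtain ⟨ε, hε, hex⟩ := exists_isSolutionOn_Icc_of_isCompact hM hgω hB' hX hXM hK
  have huniq := hasUniqueSolutions_modulatedField hgω fun k => (hX k).locallyLipschitz
  -- Starting at a time `t₁` closer than `ε` to the supremum of the reached times, the solution
  -- continues for time `ε`, since it is still in `K`. If the end were not reached, `t₁ + ε` would
  -- exceed that supremum.
  have hend : t₀ + Δ ∈ I := by
    set A := I ∩ Icc t₀ (t₀ + Δ)
    have hA0 : t₀ ∈ A := ⟨hx.1, le_rfl, by linarith⟩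
    have hAb : BddAbove A := ⟨t₀ + Δ, fun t ht => ht.2.2⟩
    obtain ⟨t₁, ht₁, hlt₁⟩ := exists_lt_of_lt_csSup ⟨t₀, hA0⟩ (sub_lt_self (sSup A) hε)
    have hxK : x t₁ ∈ K := by
      refine Metric.mem_cthickening_of_dist_le (x t₁) (xbar t₁) δ C (hmem t₁ ht₁.2).2 ?_
      rw [Subtype.dist_eq, dist_eq_norm]
      exact (hlt t₁ ht₁.1 ht₁.2 t₁ (right_mem_Icc.2 ht₁.2.1)).le.trans (min_le_right _ _)
    obtain ⟨y, hy, hyx⟩ := hex t₁ (x t₁) hxK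
    have hsub := hx.subset huniq ht₁.1 hy (left_mem_Icc.2 (by linarith)) hyx
    by_contra hnot
    have h1 : t₁ + ε < t₀ + Δ := by
      by_contra! h
      exact hnot (hsub ⟨ht₁.2.2, h⟩)
    have h2 : t₁ + ε ∈ A :=
      ⟨hsub (right_mem_Icc.2 (by linarith)), by linarith [ht₁.2.1], h1.le⟩
    linarith [le_csSup hAb h2]
  intro t ht
  exact ⟨hxI.1.out hx.1 hend ht, (hlt _ hend ⟨by linarith, le_rfl⟩ t ht).le.trans (min_le_left _ _)⟩

end Averaging

/-! ## Projections -/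

section Projection

variable {E : Type*} [NormedAddCommGroup E] [InnerProductSpace ℝ E] [FiniteDimensional ℝ E]

/-- The square of `P + P* - 1` is `1 + (P - P*)(P - P*)*`, which is at least the identity, so the
operator is injective and, in finite dimension, invertible. -/
theorem isUnit_add_star_sub_one {P : E →L[ℝ] E} (hP : P * P = P) : IsUnit (P + star P - 1) := by
  have hP₂ : star P * star P = star P := by rw [← star_mul, hP]
  set S := P + star P - 1 with hS
  have hSS : S * S = 1 + (P - star P) * star (P - star P) := by
    rw [hS, star_sub, star_star]
    simp only [mul_add, add_mul, mul_sub, sub_mul, hP, hP₂, mul_one, one_mul]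
    abel
  have hinj : Function.Injective S := by
    refine (injective_iff_map_eq_zero S).2 fun w hw => ?_
    have h1 : inner ℝ ((S * S) w) w = 0 := by
      rw [mul_apply_eq_comp, hw, map_zero, inner_zero_left]
    rw [hSS, add_apply, inner_add_left, mul_apply_eq_comp,
      one_apply_eq_self, ← ContinuousLinearMap.adjoint_inner_right,
      ContinuousLinearMap.star_eq_adjoint, real_inner_self_eq_norm_sq,
      real_inner_self_eq_norm_sq] at h1
    have h2 : ‖w‖ ^ 2 = 0 := le_antisymm (by
      linarith [sq_nonneg ‖ContinuousLinearMap.adjoint (P - star P) w‖])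
      (sq_nonneg _)
    exact norm_eq_zero.1 (pow_eq_zero_iff two_ne_zero |>.1 h2)
  exact ContinuousLinearMap.isUnit_iff_bijective.2
    ⟨hinj, LinearMap.injective_iff_surjective (f := S.toLinearMap) |>.1 hinj⟩

/-- The orthogonal projection onto the range of an oblique projection. -/
theorem starProjection_eq_mul_inverse {P : E →L[ℝ] E} {V : Submodule ℝ E} (h₁ : ∀ w, P w ∈ V)
    (h₂ : ∀ w ∈ V, P w = w) :
    IsUnit (P + star P - 1) ∧ V.starProjection = P * Ring.inverse (P + star P - 1) := by
  have hP : P * P = P := by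
    ext w
    rw [mul_apply_eq_comp, h₂ _ (h₁ w)]
  have hu := isUnit_add_star_sub_one hP
  refine ⟨hu, ?_⟩
  have e1 : V.starProjection * P = P := by
    ext w
    rw [mul_apply_eq_comp, Submodule.starProjection_eq_self_iff.2 (h₁ w)]
  have e2 : P * V.starProjection = V.starProjection := by
    ext w
    rw [mul_apply_eq_comp, h₂ _ (V.starProjection_apply_mem w)]
  have e3 : star V.starProjection = V.starProjection := isSelfAdjoint_starProjection V
  have e4 : V.starProjection * star P = V.starProjection := by
    have := congrArg star e2
    rwa [star_mul, e3] at this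
  -- With `Π` the orthogonal projection, `Π P = P` and `Π P* = Π`, so the last two contributions
  -- cancel.
  have e5 : V.starProjection * (P + star P - 1) = P := by
    rw [mul_sub, mul_add, e1, e4, mul_one, add_sub_cancel_right]
  conv_rhs => rw [← congrArg (· * Ring.inverse (P + star P - 1)) e5]
  rw [mul_assoc, Ring.mul_inverse_cancel _ hu, mul_one]

theorem contDiff_star_continuousLinearMap :
    ContDiff ℝ (⊤ : ℕ∞) (fun A : E →L[ℝ] E => star A) := by
  refine IsBoundedLinearMap.contDiff (𝕜 := ℝ) (E := E →L[ℝ] E) (F := E →L[ℝ] E) ?_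
  refine IsLinearMap.with_bound ⟨fun A B => star_add A B, fun c A => ?_⟩ 1 fun A => ?_
  · rw [star_smul, star_trivial]
  · rw [one_mul]
    exact (ContinuousLinearMap.adjoint.norm_map A).le

end Projection

/-! ## Differential calculus on submanifolds -/

section Submanifold

variable {N : ℕ} {Q : Set (Euc N)} {B : Type*} [NormedAddCommGroup B] [NormedSpace ℝ B]

/-- In a straightening chart, project linearly onto `V` and go back; the domain is cut down so that
the projected point is still in the chart's target. -/
theorem IsEmbeddedSubmanifold.isLocalSmoothRetract (hQ : IsEmbeddedSubmanifold Q) :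
    IsLocalSmoothRetract Q := by
  intro q hq
  obtain ⟨Φ, V, hqs, hΦ, hΦ', hV⟩ := hQ q hq
  have hP : ContDiffOn ℝ (⊤ : ℕ∞) (fun x => V.starProjection (Φ x)) Φ.source :=
    V.starProjection.contDiff.comp_contDiffOn hΦ
  have hfix : ∀ x ∈ Φ.source, x ∈ Q → V.starProjection (Φ x) = Φ x := fun x hx hxQ =>
    Submodule.starProjection_eq_self_iff.2 ((hV x hx).1 hxQ)
  refine ⟨Φ.source ∩ (fun x => V.starProjection (Φ x)) ⁻¹' Φ.target,
    fun x => Φ.symm (V.starProjection (Φ x)),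
    hP.continuousOn.isOpen_inter_preimage Φ.open_source Φ.open_target, ⟨hqs, ?_⟩,
    hΦ'.comp (hP.mono inter_subset_left) inter_subset_right, fun x hx => ?_, fun x hx hxQ => ?_⟩
  · rw [mem_preimage, hfix q hqs hq]
    exact Φ.map_source hqs
  · rw [hV _ (Φ.map_target hx.2), Φ.right_inv hx.2]
    exact V.starProjection_apply_mem _
  · simp only [hfix x hx.1 hxQ, Φ.left_inv hx.1]

theorem extend_apply {B : Type*} [Zero B] (f : Q → B) (q : Q) :
    Function.extend Subtype.val f 0 (q : Euc N) = f q :=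
  Subtype.val_injective.extend_apply f 0 q

theorem hasFDerivWithinAt_extend {f : Q → B} {q : Q} {g : Euc N → B} {U : Set (Euc N)}
    (hU : IsOpen U) (hqU : (q : Euc N) ∈ U) (hg : ContDiffOn ℝ (⊤ : ℕ∞) g U)
    (h : ∀ y : Q, (y : Euc N) ∈ U → f y = g y) :
    HasFDerivWithinAt (Function.extend Subtype.val f 0) (fderiv ℝ g q) Q q := by
  have h1 : HasFDerivAt g (fderiv ℝ g q) q :=
    ((hg.contDiffAt (hU.mem_nhds hqU)).differentiableAt (by simp)).hasFDerivAt
  refine h1.hasFDerivWithinAt.congr_of_eventuallyEq ?_ ((extend_apply f q).trans (h q hqU))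
  filter_upwards [self_mem_nhdsWithin, mem_nhdsWithin_of_mem_nhds (hU.mem_nhds hqU)] with x hx hxU
  exact (extend_apply f ⟨x, hx⟩).trans (h ⟨x, hx⟩ hxU)

theorem IsSmooth.hasFDerivWithinAt {f : Q → B} (hf : IsSmooth f) (q : Q) :
    HasFDerivWithinAt (Function.extend Subtype.val f 0)
      (fderivWithin ℝ (Function.extend Subtype.val f 0) Q q) Q q := by
  obtain ⟨U, hU, hqU, g, hg, h⟩ := hf q
  exact (hasFDerivWithinAt_extend hU hqU hg h).differentiableWithinAt.hasFDerivWithinAt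

/-- `fderivWithin` is an arbitrary choice in directions normal to `Q`; on tangent vectors every
derivative within `Q` has the same value, so the usual calculus rules carry over. -/
theorem dirDeriv_eq_of_hasFDerivWithinAt {f : Q → B} {q : Q} {f' : Euc N →L[ℝ] B}
    (hf : HasFDerivWithinAt (Function.extend Subtype.val f 0) f' Q q) {v : Euc N}
    (hv : v ∈ tangentSpace Q q) : dirDeriv f q v = f' v :=
  velocitySpan_eq_of_hasFDerivWithinAt hf.differentiableWithinAt.hasFDerivWithinAt hf hv

theorem dirDeriv_eq_of_eq {f : Q → B} {g : Euc N → B} {q : Q} {g' : Euc N →L[ℝ] B}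
    (hg : HasFDerivWithinAt g g' Q q) (h : ∀ p : Q, f p = g p) {v : Euc N}
    (hv : v ∈ tangentSpace Q q) : dirDeriv f q v = g' v :=
  dirDeriv_eq_of_hasFDerivWithinAt (hg.congr
    (fun x hx => (extend_apply f ⟨x, hx⟩).trans (h ⟨x, hx⟩)) ((extend_apply f q).trans (h q))) hv

theorem dirDeriv_add {f g : Q → B} (hf : IsSmooth f) (hg : IsSmooth g) {q : Q} {v : Euc N}
    (hv : v ∈ tangentSpace Q q) :
    dirDeriv (fun p => f p + g p) q v = dirDeriv f q v + dirDeriv g q v := by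
  refine dirDeriv_eq_of_eq ((hf.hasFDerivWithinAt q).add (hg.hasFDerivWithinAt q)) (fun p => ?_) hv
  exact congrArg₂ (· + ·) (extend_apply f p).symm (extend_apply g p).symm

theorem dirDeriv_smul {f : Q → ℝ} {g : Q → B} (hf : IsSmooth f) (hg : IsSmooth g) {q : Q}
    {v : Euc N} (hv : v ∈ tangentSpace Q q) :
    dirDeriv (fun p => f p • g p) q v = f q • dirDeriv g q v + dirDeriv f q v • g q := by
  rw [dirDeriv_eq_of_eq ((hf.hasFDerivWithinAt q).smul (hg.hasFDerivWithinAt q)) (fun p => ?_) hv]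
  · simp only [extend_apply]
    rfl
  · exact congrArg₂ (· • ·) (extend_apply f p).symm (extend_apply g p).symm

theorem dirDeriv_const (c : B) {q : Q} {v : Euc N} (hv : v ∈ tangentSpace Q q) :
    dirDeriv (fun _ : Q => c) q v = 0 :=
  dirDeriv_eq_of_eq (hasFDerivWithinAt_const c (q : Euc N) Q) (fun _ => rfl) hv

theorem dirDeriv_sum {ι : Type*} {s : Finset ι} {f : ι → Q → B} (hf : ∀ i ∈ s, IsSmooth (f i))
    {q : Q} {v : Euc N} (hv : v ∈ tangentSpace Q q) :
    dirDeriv (fun p => ∑ i ∈ s, f i p) q v = ∑ i ∈ s, dirDeriv (f i) q v := by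
  classical
  induction s using Finset.induction_on with
  | empty => simpa using dirDeriv_const (0 : B) hv
  | insert i s hi ih =>
    simp only [Finset.sum_insert hi]
    have hf' : ∀ j ∈ s, IsSmooth (f j) := fun j hj => hf j (Finset.mem_insert_of_mem hj)
    rw [dirDeriv_add (hf i (Finset.mem_insert_self i s)) (IsSmooth.sum hf') hv, ih hf']

theorem IsSmooth.dirDeriv {f : Q → B} (hf : IsSmooth f) :
    IsSmooth (S := tangentBundle Q) fun p => dirDeriv f ⟨p.1.1, p.2.1⟩ p.1.2 := by
  intro p
  obtain ⟨U, hU, hqU, g, hg, h⟩ := hf ⟨p.1.1, p.2.1⟩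
  refine ⟨Prod.fst ⁻¹' U, hU.preimage continuous_fst, hqU, fun x => fderiv ℝ g x.1 x.2, ?_,
    fun y hy => dirDeriv_eq_of_hasFDerivWithinAt (q := ⟨y.1.1, y.2.1⟩)
      (hasFDerivWithinAt_extend hU hy hg h) y.2.2⟩
  have h1 : ContDiffOn ℝ (⊤ : ℕ∞) (fderiv ℝ g) U := hg.fderiv_of_isOpen hU (by simp)
  exact (h1.comp contDiff_fst.contDiffOn fun x hx => hx).clm_apply contDiff_snd.contDiffOn

theorem IsSmooth.hasDerivWithinAt_comp {f : Q → B} (hf : IsSmooth f) {x : ℝ → Q} {v : Euc N}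
    {I : Set ℝ} {t : ℝ} (hx : HasDerivWithinAt (fun t => (x t : Euc N)) v I t) :
    HasDerivWithinAt (fun t => f (x t)) (ESC.dirDeriv f (x t) v) I t := by
  have := (hf.hasFDerivWithinAt (x t)).comp_hasDerivWithinAt t hx fun s _ => (x s).2
  refine this.congr (fun s _ => ?_) ?_ <;> exact (extend_apply f _).symm

/-- Retractions exist only locally, whereas the orthogonal projection is canonical and so yields
globally defined vector fields. Near a point it is a smooth function of the derivative of a local
retraction, which is an oblique projection onto the tangent space. -/
theorem IsLocalSmoothRetract.isSmooth_starProjection (hQ : IsLocalSmoothRetract Q) :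
    IsSmooth fun q : Q => (tangentSpace Q (q : Euc N)).starProjection := by
  intro q
  obtain ⟨U, r, hU, hqU, hr, hrQ, hrQ'⟩ := hQ q q.2
  set D : Euc N → Euc N →L[ℝ] Euc N := fderiv ℝ r
  set S : Euc N → Euc N →L[ℝ] Euc N := fun x => D x + star (D x) - 1
  have hD : ContDiffOn ℝ (⊤ : ℕ∞) D U := hr.fderiv_of_isOpen hU (by simp)
  have hS : ContDiffOn ℝ (⊤ : ℕ∞) S U :=
    (hD.add (contDiff_star_continuousLinearMap.comp_contDiffOn hD)).sub contDiffOn_const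
  have key : ∀ y : Q, (y : Euc N) ∈ U → IsUnit (S y) ∧
      (tangentSpace Q (y : Euc N)).starProjection = D y * Ring.inverse (S y) := fun y hy =>
    starProjection_eq_mul_inverse
      (fun w => by
        have := fderiv_retraction_mem_velocitySpan hU hr hrQ hy w
        rwa [hrQ' y hy y.2] at this)
      (fun w hw => fderiv_retraction_apply hU hr hrQ' hy y.2 hw)
  refine ⟨U ∩ S ⁻¹' {A | IsUnit A}, hS.continuousOn.isOpen_inter_preimage hU Units.isOpen,
    ⟨hqU, (key q hqU).1⟩, fun x => D x * Ring.inverse (S x), ?_, fun y hy => (key y hy.1).2⟩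
  have hinv : ContDiffOn ℝ (⊤ : ℕ∞) (fun x => Ring.inverse (S x)) (U ∩ S ⁻¹' {A | IsUnit A}) := by
    intro x hx
    obtain ⟨A, hA⟩ := hx.2
    have h1 : ContDiffAt ℝ (⊤ : ℕ∞) Ring.inverse (S x) := hA ▸ contDiffAt_ringInverse ℝ A
    exact h1.comp_contDiffWithinAt x ((hS x hx.1).mono inter_subset_left)
  exact (hD.mono inter_subset_left).mul hinv

end Submanifold

/-! ## Affine connections -/

section Connection

variable {N : ℕ} {Q : Set (Euc N)}

instance : Zero (VectorField Q) where
  zero := ⟨fun _ => 0, fun _ => zero_mem _, IsSmooth.const 0⟩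

theorem VectorField.ext {X Y : VectorField Q} (h : ∀ q, X q = Y q) : X = Y := by
  cases X; cases Y
  congr
  exact funext h

instance : AddCommMonoid (VectorField Q) where
  add_assoc X Y Z := VectorField.ext fun q => add_assoc (X q) (Y q) (Z q)
  zero_add X := VectorField.ext fun q => zero_add (X q)
  add_zero X := VectorField.ext fun q => add_zero (X q)
  add_comm X Y := VectorField.ext fun q => add_comm (X q) (Y q)
  nsmul := nsmulRec

/-- Evaluation of vector fields at a point. -/
def VectorField.eval (q : Q) : VectorField Q →+ Euc N where
  toFun X := X q
  map_zero' := rfl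
  map_add' _ _ := rfl

theorem VectorField.sum_apply {ι : Type*} (s : Finset ι) (X : ι → VectorField Q) (q : Q) :
    (∑ i ∈ s, X i) q = ∑ i ∈ s, X i q :=
  map_sum (VectorField.eval q) X s

/-- The tangential part of a constant vector field. -/
def projField (hQ : IsLocalSmoothRetract Q) (v : Euc N) : VectorField Q where
  toFun q := (tangentSpace Q (q : Euc N)).starProjection v
  tangent _ := Submodule.starProjection_apply_mem _ v
  smooth := hQ.isSmooth_starProjection.contDiff_comp
    (ContinuousLinearMap.apply ℝ (Euc N) v).contDiff

theorem projField_apply (hQ : IsLocalSmoothRetract Q) {q : Q} {v : Euc N}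
    (hv : v ∈ tangentSpace Q (q : Euc N)) : projField hQ v q = v :=
  Submodule.starProjection_eq_self_iff.2 hv

/-- The tangential part of the `k`-th coordinate vector field. -/
def frame (hQ : IsLocalSmoothRetract Q) (k : Fin N) : VectorField Q :=
  projField hQ (EuclideanSpace.single k 1)

theorem sum_coord_smul_frame (hQ : IsLocalSmoothRetract Q) (q : Q) (v : Euc N) :
    ∑ k, v k • frame hQ k q = projField hQ v q := by
  have : v = ∑ k, v k • EuclideanSpace.single k (1 : ℝ) := by
    ext j
    simp [Finset.sum_apply, Pi.single_apply]
  conv_rhs => rw [this]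
  change _ = (tangentSpace Q (q : Euc N)).starProjection _
  rw [map_sum]
  simp only [map_smul]
  rfl

/-- The `k`-th component of a vector field. -/
def VectorField.coord (Y : VectorField Q) (k : Fin N) : SmoothFunction Q where
  toFun q := Y q k
  smooth := Y.smooth.contDiff_comp (k := fun v : Euc N => v k) (by fun_prop)

/-- The projected coordinate fields span globally with smooth coefficients, so tensoriality of the
connection follows from its algebraic laws without cutoff functions. -/
theorem VectorField.eq_sum_coord_smul_frame (hQ : IsLocalSmoothRetract Q) (Y : VectorField Q) :
    Y = ∑ k, Y.coord k • frame hQ k := by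
  refine VectorField.ext fun q => ?_
  rw [VectorField.sum_apply]
  exact ((sum_coord_smul_frame hQ q (Y q)).trans (projField_apply hQ (Y.tangent q))).symm

variable (conn : AffineConnection Q) (hQ : IsLocalSmoothRetract Q)

/-- `∇_X` as an additive map. -/
def AffineConnection.covRight (X : VectorField Q) : VectorField Q →+ VectorField Q where
  toFun Y := conn.cov X Y
  map_zero' := by
    refine VectorField.ext fun q => ?_
    have h := congrArg (VectorField.eval q) (conn.add_right X 0 0)
    rw [add_zero, map_add] at h
    exact left_eq_add.1 h
  map_add' := conn.add_right X

/-- `∇_· Y` as an additive map. -/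
def AffineConnection.covLeft (Y : VectorField Q) : VectorField Q →+ VectorField Q where
  toFun X := conn.cov X Y
  map_zero' := by
    refine VectorField.ext fun q => ?_
    have h := congrArg (VectorField.eval q) (conn.add_left 0 0 Y)
    rw [add_zero, map_add] at h
    exact left_eq_add.1 h
  map_add' X X' := conn.add_left X X' Y

/-- The covariant derivative of a vector field in the direction of a vector. -/
def AffineConnection.covAt (q : Q) (Y : VectorField Q) : Euc N →ₗ[ℝ] Euc N :=
  ∑ j, (EuclideanSpace.proj j : Euc N →L[ℝ] ℝ).toLinearMap.smulRight (conn.cov (frame hQ j) Y q)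

theorem AffineConnection.covAt_apply (q : Q) (Y : VectorField Q) (w : Euc N) :
    conn.covAt hQ q Y w = ∑ j, w j • conn.cov (frame hQ j) Y q := by
  simp [AffineConnection.covAt]

theorem AffineConnection.covAt_mem (q : Q) (Y : VectorField Q) (w : Euc N) :
    conn.covAt hQ q Y w ∈ tangentSpace Q (q : Euc N) := by
  rw [conn.covAt_apply]
  exact Submodule.sum_mem _ fun j _ => Submodule.smul_mem _ _ ((conn.cov _ Y).tangent q)

/-- Expanding `X` in the frame and using function-linearity in the first slot shows that the
covariant derivative at `q` depends on `X` only through `X q`. -/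
theorem AffineConnection.covAt_vectorField (q : Q) (X Y : VectorField Q) :
    conn.covAt hQ q Y (X q) = conn.cov X Y q := by
  have h := congrArg (fun Z => conn.covLeft Y Z q) (X.eq_sum_coord_smul_frame hQ)
  simp only [map_sum, VectorField.sum_apply] at h
  rw [conn.covAt_apply]
  refine Eq.trans (Finset.sum_congr rfl fun j _ => ?_) h.symm
  change _ = conn.cov (X.coord j • frame hQ j) Y q
  rw [conn.smul_left]
  rfl

/-- The bilinear map whose value at `(w, Y(q))` is `D_w Y - ∇_w Y` for every vector field `Y`. -/
def AffineConnection.bilinSpray (q : Q) : Euc N →ₗ[ℝ] Euc N →ₗ[ℝ] Euc N :=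
  LinearMap.flip (∑ k, (EuclideanSpace.proj k : Euc N →L[ℝ] ℝ).toLinearMap.smulRight
    ((fderivWithin ℝ (Function.extend Subtype.val (frame hQ k) 0) Q q).toLinearMap -
      conn.covAt hQ q (frame hQ k)))

theorem AffineConnection.bilinSpray_apply (q : Q) (w v : Euc N) : conn.bilinSpray hQ q w v =
    ∑ k, v k • (dirDeriv (frame hQ k) q w - conn.covAt hQ q (frame hQ k) w) := by
  simp [AffineConnection.bilinSpray, dirDeriv, LinearMap.sum_apply]

/-- The ambient derivative and the covariant derivative obey the same Leibniz rule, so in their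
difference the derivatives of the frame coefficients of `Y` cancel and only `Y q` matters. -/
theorem AffineConnection.bilinSpray_vectorField (q : Q) {w : Euc N}
    (hw : w ∈ tangentSpace Q (q : Euc N)) (Y : VectorField Q) :
    conn.bilinSpray hQ q w (Y q) = dirDeriv Y q w - conn.covAt hQ q Y w := by
  have hd : dirDeriv Y q w = ∑ k, (Y q k • dirDeriv (frame hQ k) q w +
      dirDeriv (Y.coord k) q w • frame hQ k q) := by
    have h1 : (Y : Q → Euc N) = fun p => ∑ k, Y.coord k p • frame hQ k p := by
      funext p
      conv_lhs => rw [Y.eq_sum_coord_smul_frame hQ]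
      rw [VectorField.sum_apply]
      rfl
    conv_lhs => rw [h1]
    rw [dirDeriv_sum (fun k _ => (Y.coord k).smooth.smul (frame hQ k).smooth) hw]
    exact Finset.sum_congr rfl fun k _ =>
      dirDeriv_smul (Y.coord k).smooth (frame hQ k).smooth hw
  have hc : conn.covAt hQ q Y w = ∑ k, (Y q k • conn.covAt hQ q (frame hQ k) w +
      dirDeriv (Y.coord k) q w • frame hQ k q) := by
    have hwX : projField hQ w q = w := projField_apply hQ hw
    set X := projField hQ w
    have h := congrArg (fun Z => conn.covRight X Z q) (Y.eq_sum_coord_smul_frame hQ)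
    simp only [map_sum, VectorField.sum_apply] at h
    rw [← hwX, conn.covAt_vectorField]
    refine h.trans (Finset.sum_congr rfl fun k _ => ?_)
    rw [conn.covAt_vectorField]
    exact conn.leibniz (Y.coord k) X (frame hQ k) q
  rw [conn.bilinSpray_apply, hd, hc, ← Finset.sum_sub_distrib]
  refine Finset.sum_congr rfl fun k _ => ?_
  rw [smul_sub, add_sub_add_right_eq_sub]

/-- Removes the arbitrary choice of vector field from the spray and makes it visibly quadratic in
`v`. -/
theorem AffineConnection.spray_eq (q : Q) {v : Euc N} (hv : v ∈ tangentSpace Q (q : Euc N)) :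
    conn.spray q v = conn.bilinSpray hQ q v v := by
  have h : ∃ Y : VectorField Q, Y q = v := ⟨projField hQ v, projField_apply hQ hv⟩
  rw [AffineConnection.spray, dif_pos h]
  have hs := h.choose_spec
  set Y := h.choose
  have h1 := conn.bilinSpray_vectorField hQ q hv Y
  rw [hs] at h1
  rw [h1]
  have h2 := conn.covAt_vectorField hQ q Y Y
  rw [hs] at h2
  rw [h2]

end Connection

/-! ## The state space -/

section StateSpace

variable {N : ℕ} {Q : Set (Euc N)} {B : Type*} [NormedAddCommGroup B] [NormedSpace ℝ B]

/-- The projection to the configuration. -/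
def posL (N : ℕ) : Ambient N →L[ℝ] Euc N := WithLp.fstL 2 ℝ _ _

/-- The projection to the velocity. -/
def velL (N : ℕ) : Ambient N →L[ℝ] Euc N := (WithLp.fstL 2 ℝ _ _).comp (WithLp.sndL 2 ℝ _ _)

/-- The projection to the filter state. -/
def filtL (N : ℕ) : Ambient N →L[ℝ] ℝ := (WithLp.sndL 2 ℝ _ _).comp (WithLp.sndL 2 ℝ _ _)

/-- `mk` as a continuous linear map. -/
def mkL (N : ℕ) : Euc N × Euc N × ℝ →L[ℝ] Ambient N :=
  (WithLp.prodContinuousLinearEquiv 2 ℝ _ _).symm.toContinuousLinearMap.comp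
    ((ContinuousLinearMap.id ℝ (Euc N)).prodMap
      (WithLp.prodContinuousLinearEquiv 2 ℝ _ _).symm.toContinuousLinearMap)

theorem mkL_apply (q v : Euc N) (η : ℝ) : mkL N (q, v, η) = mk q v η := rfl

theorem posL_mk (q v : Euc N) (η : ℝ) : posL N (mk q v η) = q := rfl

theorem filtL_mk (q v : Euc N) (η : ℝ) : filtL N (mk q v η) = η := rfl

theorem mk_posL_velL_filtL (x : Ambient N) : mk (posL N x) (velL N x) (filtL N x) = x := rfl

theorem mk_add (q q' v v' : Euc N) (η η' : ℝ) :
    mk q v η + mk q' v' η' = mk (q + q') (v + v') (η + η') := rfl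

theorem smul_mk (c : ℝ) (q v : Euc N) (η : ℝ) : c • mk q v η = mk (c • q) (c • v) (c * η) := rfl

theorem sum_mk {ι : Type*} (s : Finset ι) (q v : ι → Euc N) (η : ι → ℝ) :
    ∑ i ∈ s, mk (q i) (v i) (η i) = mk (∑ i ∈ s, q i) (∑ i ∈ s, v i) (∑ i ∈ s, η i) := by
  simp only [← mkL_apply, ← map_sum]
  congr 1
  simp [Prod.ext_iff, Prod.fst_sum, Prod.snd_sum]

theorem isSmooth_pos : IsSmooth fun x : stateSpace Q => (pos x : Euc N) :=
  IsSmooth.of_contDiff (posL N).contDiff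

theorem isSmooth_vel : IsSmooth fun x : stateSpace Q => (vel x : Euc N) :=
  IsSmooth.of_contDiff (velL N).contDiff

theorem isSmooth_filt : IsSmooth fun x : stateSpace Q => filt x :=
  IsSmooth.of_contDiff (filtL N).contDiff

theorem IsSmooth.comp_pos {f : Q → B} (hf : IsSmooth f) :
    IsSmooth fun x : stateSpace Q => f (pos x) :=
  hf.comp isSmooth_pos

theorem IsSmooth.mk {q v : stateSpace Q → Euc N} {η : stateSpace Q → ℝ} (hq : IsSmooth q)
    (hv : IsSmooth v) (hη : IsSmooth η) : IsSmooth fun x => mk (q x) (v x) (η x) :=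
  (hq.prodMk (hv.prodMk hη)).contDiff_comp (mkL N).contDiff

/-- A tangent vector as a point of the tangent bundle. -/
def tangentVector (q : Q) (w : Euc N) (hw : w ∈ tangentSpace Q (q : Euc N)) : tangentBundle Q :=
  ⟨((q : Euc N), w), And.intro q.2 hw⟩

theorem IsSmooth.comp_tangentVector {f : tangentBundle Q → B} (hf : IsSmooth f)
    {w : stateSpace Q → Euc N} (hw : IsSmooth w)
    (hwT : ∀ x : stateSpace Q, w x ∈ tangentSpace Q (pos x : Euc N)) :
    IsSmooth fun x : stateSpace Q => f (tangentVector (pos x) (w x) (hwT x)) := by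
  have h1 : IsSmooth fun x : stateSpace Q =>
      (tangentVector (pos x) (w x) (hwT x) : Euc N × Euc N) := isSmooth_pos.prodMk hw
  exact hf.comp h1

theorem IsSmooth.dirDeriv_pos {f : Q → B} (hf : IsSmooth f) {w : stateSpace Q → Euc N}
    (hw : IsSmooth w) (hwT : ∀ x, w x ∈ tangentSpace Q (pos x : Euc N)) :
    IsSmooth fun x => ESC.dirDeriv f (pos x) (w x) :=
  hf.dirDeriv.comp_tangentVector hw hwT

theorem isSmooth_bundleMap (R : BundleMap Q)
    {w : (x : stateSpace Q) → tangentSpace Q (pos x : Euc N)}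
    (hw : IsSmooth fun x => (w x : Euc N)) :
    IsSmooth fun x => (R.toFun (pos x) (w x) : Euc N) :=
  R.smooth.comp_tangentVector hw fun x => (w x).2

theorem isSmooth_coord {v : stateSpace Q → Euc N} (hv : IsSmooth v) (k : Fin N) :
    IsSmooth fun x => v x k :=
  hv.contDiff_comp (k := fun v : Euc N => v k) (by fun_prop)

variable (conn : AffineConnection Q) (hQ : IsLocalSmoothRetract Q)

theorem isSmooth_covAt (Y : VectorField Q) {w : stateSpace Q → Euc N} (hw : IsSmooth w) :
    IsSmooth fun x => conn.covAt hQ (pos x) Y (w x) := by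
  simp only [conn.covAt_apply]
  exact IsSmooth.sum fun j _ => (isSmooth_coord hw j).smul (conn.cov _ Y).smooth.comp_pos

theorem isSmooth_bilinSpray {w v : stateSpace Q → Euc N} (hw : IsSmooth w)
    (hwT : ∀ x, w x ∈ tangentSpace Q (pos x : Euc N)) (hv : IsSmooth v) :
    IsSmooth fun x => conn.bilinSpray hQ (pos x) (w x) (v x) := by
  simp only [conn.bilinSpray_apply]
  exact IsSmooth.sum fun k _ => (isSmooth_coord hv k).smul
    (((frame hQ k).smooth.dirDeriv_pos hw hwT).sub (isSmooth_covAt conn hQ _ hw))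

/-- A curve `γ` in `Q` lifts to the curve `(γ, Z ∘ γ, η)` in the state space. The resulting velocity
is linear in `w`, so it suffices to treat velocities of curves. -/
theorem mk_dirDeriv_mem_velocitySpan (x : stateSpace Q) (Z : VectorField Q)
    (hZ : Z (pos x) = vel x) {w : Euc N} (hw : w ∈ tangentSpace Q (pos x : Euc N)) :
    mk w (dirDeriv Z (pos x) w) 0 ∈ velocitySpan (stateSpace Q) (x : Ambient N) := by
  set D := fderivWithin ℝ (Function.extend Subtype.val (Z : Q → Euc N) 0) Q (pos x)
  set ℓ : Euc N →L[ℝ] Ambient N :=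
    (mkL N).comp ((ContinuousLinearMap.id ℝ (Euc N)).prod (D.prod 0)) with hℓ
  have : tangentSpace Q (pos x : Euc N) ≤
      (velocitySpan (stateSpace Q) (x : Ambient N)).comap ℓ.toLinearMap := by
    refine Submodule.span_le.2 ?_
    rintro w ⟨γ, hγ0, hγ, hw⟩
    have hD : HasFDerivWithinAt (Function.extend Subtype.val (Z : Q → Euc N) 0) D Q (γ 0) := by
      rw [hγ0]
      exact Z.smooth.hasFDerivWithinAt (pos x)
    have h1 := hD.comp_hasDerivAt 0 hw hγ
    have h2 := (mkL N).hasFDerivAt.comp_hasDerivAt (0 : ℝ)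
      (hw.prodMk (h1.prodMk (hasDerivAt_const (0 : ℝ) (filt x))))
    refine Submodule.subset_span ⟨_, ?_, ?_, h2⟩
    · simp only [Function.comp_apply, hγ0, extend_apply, hZ]
      rfl
    · filter_upwards [hγ] with t ht
      refine ⟨ht, ?_⟩
      change Function.extend Subtype.val (Z : Q → Euc N) 0 (γ t) ∈ tangentSpace Q (γ t)
      rw [extend_apply _ ⟨γ t, ht⟩]
      exact Z.tangent ⟨γ t, ht⟩
  exact this hw

theorem hasDerivAt_add_smul (y v : B) : HasDerivAt (fun t : ℝ => y + t • v) v 0 := by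
  simpa using ((hasDerivAt_id (0 : ℝ)).smul_const v).const_add y

theorem mk_zero_mem_velocitySpan (x : stateSpace Q) {u : Euc N} (c : ℝ)
    (hu : u ∈ tangentSpace Q (pos x : Euc N)) :
    mk 0 u c ∈ velocitySpan (stateSpace Q) (x : Ambient N) := by
  have h := hasDerivAt_add_smul (x : Ambient N) (mk 0 u c)
  refine Submodule.subset_span ⟨_, by simp, .of_forall fun t => ?_, h⟩
  have e : (x : Ambient N) + t • mk 0 u c =
      mk (pos x) ((vel x : Euc N) + t • u) (filt x + t * c) := by
    rw [smul_mk, smul_zero]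
    change mk (pos x : Euc N) (vel x) (filt x) + _ = _
    rw [mk_add, add_zero]
  rw [e]
  exact ⟨(pos x).2, add_mem (vel x).2 (Submodule.smul_mem _ _ hu)⟩

/-- Tangent vectors to the state space at `(q, v, η)`. -/
theorem mk_bilinSpray_mem_velocitySpan (x : stateSpace Q) {w u : Euc N} (c : ℝ)
    (hw : w ∈ tangentSpace Q (pos x : Euc N)) (hu : u ∈ tangentSpace Q (pos x : Euc N)) :
    mk w (conn.bilinSpray hQ (pos x) w (vel x) + u) c ∈
      velocitySpan (stateSpace Q) (x : Ambient N) := by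
  -- For a field `Z` through the given velocity, `S(w, v) = D_w Z - ∇_w Z`: the first term comes
  -- from lifting along `Z`, and the second is tangent, hence a fibre direction.
  have hZ : projField hQ (vel x) (pos x) = vel x := projField_apply hQ (vel x).2
  have h1 := mk_dirDeriv_mem_velocitySpan x (projField hQ (vel x)) hZ hw
  have h2 := mk_zero_mem_velocitySpan x c
    (sub_mem hu (conn.covAt_mem hQ (pos x) (projField hQ (vel x)) w))
  have h3 := add_mem h1 h2
  have h4 := conn.bilinSpray_vectorField hQ (pos x) hw (projField hQ (vel x))
  rw [hZ] at h4
  rw [mk_add, add_zero, zero_add] at h3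
  rwa [h4, sub_add_eq_add_sub, add_sub_assoc]

/-- The retraction is the tangent map of `r` together with the identity in `η`. -/
theorem IsLocalSmoothRetract.stateSpace (hQ : IsLocalSmoothRetract Q) :
    IsLocalSmoothRetract (stateSpace Q) := by
  intro x hx
  obtain ⟨U, r, hU, hxU, hr, hrQ, hrQ'⟩ := hQ (posL N x) hx.1
  refine ⟨posL N ⁻¹' U,
    fun y => ESC.mk (r (posL N y)) (fderiv ℝ r (posL N y) (velL N y)) (filtL N y),
    hU.preimage (posL N).continuous, hxU, ?_, fun y hy => ?_, fun y hy hyS => ?_⟩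
  · have h1 : ContDiffOn ℝ (⊤ : ℕ∞) (fun y => r (posL N y)) (posL N ⁻¹' U) :=
      hr.comp (posL N).contDiff.contDiffOn fun y hy => hy
    have h2 : ContDiffOn ℝ (⊤ : ℕ∞) (fderiv ℝ r) U := hr.fderiv_of_isOpen hU (by simp)
    have h3 := (h2.comp (posL N).contDiff.contDiffOn fun y (hy : y ∈ posL N ⁻¹' U) => hy).clm_apply
      (velL N).contDiff.contDiffOn
    exact (mkL N).contDiff.comp_contDiffOn
      (h1.prodMk (h3.prodMk (filtL N).contDiff.contDiffOn))
  · exact ⟨hrQ _ hy, fderiv_retraction_mem_velocitySpan hU hr hrQ hy _⟩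
  · have e1 : r (posL N y) = posL N y := hrQ' _ hy hyS.1
    have e2 : fderiv ℝ r (posL N y) (velL N y) = velL N y :=
      fderiv_retraction_apply hU hr hrQ' hy hyS.1 hyS.2
    simp only [e1, e2, mk_posL_velL_filtL]

end StateSpace

/-! ## The harmonics of the transformed closed-loop system -/

section Harmonics

/-- Pointwise algebra of the change of variables. Here `a i` stands for `U^i`, `c i` for `λ^i α`, `d
i` for `λ^i α'`, `f i` and `m i` for the dither and mean amplitudes, `P` for the differential of
`ψ`, `e` for the filter rate, `C i` for the covariant and `D i` for the ambient derivative of `Y i`.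
The last sum is the rate of the velocity shift; the rest is grouped by degree in `a`. -/
theorem spray_add_sum_eq {E ι : Type*} [AddCommGroup E] [Module ℝ E] [Fintype ι]
    (S : E →ₗ[ℝ] E →ₗ[ℝ] E) (C : ι → E →ₗ[ℝ] E) (P : E →ₗ[ℝ] ℝ) (Y D R : ι → E)
    (a c d f m : ι → ℝ) (e : ℝ) {v w Rv Rw : E} (Y₀ : E) (hv : v = w + ∑ i, a i • c i • Y i)
    (hS : ∀ i, S v (Y i) = D i - C i v) (hR : Rv = Rw + ∑ i, a i • c i • R i) :
    S v v + (Y₀ - Rv + ∑ i, (f i + m i) • Y i) =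
      (S w w + (Y₀ - Rw + ∑ i, m i • Y i)) +
        (∑ i, a i • (S (c i • Y i) w + (-(c i • (C i w + R i)) - (d i * (P w - e)) • Y i)) +
          ∑ i, ∑ j, (a i * a j) • (-((c i * c j) • C i (Y j)) - (d i * c j * P (Y j)) • Y i)) +
        ∑ i, (f i • Y i + a i • ((d i * (P v - e)) • Y i + c i • D i)) := by
  -- `S` need not be symmetric. Expanding the second slot first keeps the full `v` in `S v (Y i)`,
  -- which is the form to which `hS` applies and which produces the cancelling `D i`.
  have hSv : S v v = S w w + ∑ i, a i • c i • S (Y i) w + ∑ i, a i • c i • S v (Y i) := by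
    conv_lhs => rw [hv, map_add (S _), ← hv, map_sum]
    conv_lhs => enter [1]; rw [hv, map_add, map_sum]
    simp only [map_smul, LinearMap.add_apply, LinearMap.sum_apply, LinearMap.smul_apply]
  have hC : ∀ i, C i v - C i w = ∑ j, a j • c j • C i (Y j) := fun i => by
    rw [hv, map_add, add_sub_cancel_left, map_sum]
    simp only [map_smul]
  have hP : P v - P w = ∑ j, a j * (c j * P (Y j)) := by
    rw [hv, map_add, add_sub_cancel_left, map_sum]
    simp only [map_smul, smul_eq_mul]
  have hj : ∀ i, ∑ j, (a i * a j) • (-((c i * c j) • C i (Y j)) - (d i * c j * P (Y j)) • Y i) =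
      -((a i * c i) • (C i v - C i w)) - (a i * d i * (P v - P w)) • Y i := fun i => by
    rw [hC, hP, Finset.smul_sum, Finset.mul_sum, Finset.sum_smul, ← Finset.sum_neg_distrib,
      ← Finset.sum_sub_distrib]
    exact Finset.sum_congr rfl fun j _ => by module
  have hsum : (∑ i, a i • c i • S (Y i) w + ∑ i, a i • c i • S v (Y i)) -
      ∑ i, a i • c i • R i + ∑ i, (f i + m i) • Y i =
      ∑ i, m i • Y i +
        (∑ i, a i • (S (c i • Y i) w + (-(c i • (C i w + R i)) - (d i * (P w - e)) • Y i)) +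
          ∑ i, (-((a i * c i) • (C i v - C i w)) - (a i * d i * (P v - P w)) • Y i)) +
        ∑ i, (f i • Y i + a i • ((d i * (P v - e)) • Y i + c i • D i)) := by
    simp only [← Finset.sum_add_distrib, ← Finset.sum_sub_distrib]
    refine Finset.sum_congr rfl fun i _ => ?_
    rw [hS, map_smul, LinearMap.smul_apply]
    module
  simp only [hj]
  rw [hSv, hR]
  have := congrArg (fun z => S w w + (Y₀ - Rw) + z) hsum
  refine Eq.trans ?_ (this.trans ?_) <;> abel

variable {N n : ℕ} {Q : Set (Euc N)} (conn : AffineConnection Q) (hQ : IsLocalSmoothRetract Q)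
  (Y₀ : VectorField Q) (Y : Fin n → VectorField Q) (R : BundleMap Q) (ψ : SmoothFunction Q)
  (α : ℝ → ℝ) (lam mu : Fin n → ℝ) (h : ℝ)

/-- The rate of change of the output error `ψ(q) - η`. -/
def errorRate (x : stateSpace Q) : ℝ :=
  dirDeriv ψ (pos x) (vel x) - (-h * filt x + h * ψ (pos x))

/-- The time-independent part of the closed-loop system. -/
def driftField (x : stateSpace Q) : Ambient N :=
  mk (vel x) (conn.bilinSpray hQ (pos x) (vel x) (vel x) + (Y₀ (pos x) - R.toFun (pos x) (vel x) +
    ∑ i, (mu i * lam i ^ 2 * α (ψ (pos x) - filt x) ^ 2) • Y i (pos x)))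
    (-h * filt x + h * ψ (pos x))

/-- The part of the transformed system that is linear in `U^i`. -/
def linearHarmonic (i : Fin n) (x : stateSpace Q) : Ambient N :=
  mk ((lam i * α (ψ (pos x) - filt x)) • Y i (pos x))
    (conn.bilinSpray hQ (pos x) ((lam i * α (ψ (pos x) - filt x)) • Y i (pos x)) (vel x) +
      (-((lam i * α (ψ (pos x) - filt x)) • (conn.covAt hQ (pos x) (Y i) (vel x) +
        R.toFun (pos x) ⟨Y i (pos x), (Y i).tangent (pos x)⟩)) -
        (lam i * deriv α (ψ (pos x) - filt x) * errorRate ψ h x) • Y i (pos x))) 0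

/-- The part of the transformed system that is proportional to `U^i U^j`. -/
def quadraticHarmonic (p : Fin n × Fin n) (x : stateSpace Q) : Ambient N :=
  mk 0 (-((lam p.1 * α (ψ (pos x) - filt x) * (lam p.2 * α (ψ (pos x) - filt x))) •
      conn.cov (Y p.2) (Y p.1) (pos x)) -
    (lam p.1 * deriv α (ψ (pos x) - filt x) * (lam p.2 * α (ψ (pos x) - filt x)) *
      lieDeriv (Y p.2) ψ (pos x)) • Y p.1 (pos x)) 0

/-- The vector fields that make up the transformed closed-loop system. -/
def harmonics : Unit ⊕ Fin n ⊕ Fin n × Fin n → stateSpace Q → Ambient N :=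
  Sum.elim (fun _ => driftField conn hQ Y₀ Y R ψ α lam mu h)
    (Sum.elim (linearHarmonic conn hQ Y R ψ α lam h) (quadraticHarmonic conn Y ψ α lam))

/-- The scalar coefficients of the harmonics. -/
def coefficients (a : Fin n → ℝ) (b : Fin n × Fin n → ℝ) : Unit ⊕ Fin n ⊕ Fin n × Fin n → ℝ :=
  Sum.elim (fun _ => 1) (Sum.elim a b)

theorem sum_coefficients_smul_harmonics (a : Fin n → ℝ) (b : Fin n × Fin n → ℝ)
    (x : stateSpace Q) :
    ∑ k, coefficients a b k • harmonics conn hQ Y₀ Y R ψ α lam mu h k x =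
      driftField conn hQ Y₀ Y R ψ α lam mu h x +
        (∑ i, a i • linearHarmonic conn hQ Y R ψ α lam h i x +
          ∑ i, ∑ j, b (i, j) • quadraticHarmonic conn Y ψ α lam (i, j) x) := by
  rw [Fintype.sum_sum_type, Fintype.sum_sum_type, Fintype.sum_prod_type]
  simp [coefficients, harmonics]

variable {α}

theorem isSmooth_error {f : ℝ → ℝ} (hf : ContDiff ℝ (⊤ : ℕ∞) f) :
    IsSmooth fun x : stateSpace Q => f (ψ (pos x) - filt x) :=
  (ψ.smooth.comp_pos.sub isSmooth_filt).contDiff_comp hf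

theorem isSmooth_filtRate : IsSmooth fun x : stateSpace Q => -h * filt x + h * ψ (pos x) :=
  ((IsSmooth.const (-h)).mul isSmooth_filt).add ((IsSmooth.const h).mul ψ.smooth.comp_pos)

theorem isSmooth_errorRate : IsSmooth (errorRate ψ h) :=
  (ψ.smooth.dirDeriv_pos isSmooth_vel fun x => (vel x).2).sub (isSmooth_filtRate ψ h)

theorem contDiff_deriv_of_top (hα : ContDiff ℝ (⊤ : ℕ∞) α) : ContDiff ℝ (⊤ : ℕ∞) (deriv α) :=
  (contDiff_infty_iff_deriv.1 hα).2

theorem isSmooth_driftField (hα : ContDiff ℝ (⊤ : ℕ∞) α) :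
    IsSmooth (driftField conn hQ Y₀ Y R ψ α lam mu h) :=
  IsSmooth.mk isSmooth_vel
    ((isSmooth_bilinSpray conn hQ isSmooth_vel (fun x => (vel x).2) isSmooth_vel).add
      ((Y₀.smooth.comp_pos.sub (isSmooth_bundleMap R isSmooth_vel)).add
        (IsSmooth.sum fun i _ => ((IsSmooth.const _).mul (isSmooth_error ψ (hα.pow 2))).smul
          (Y i).smooth.comp_pos))) (isSmooth_filtRate ψ h)

theorem isSmooth_gain (hα : ContDiff ℝ (⊤ : ℕ∞) α) (i : Fin n) :
    IsSmooth fun x : stateSpace Q => lam i * α (ψ (pos x) - filt x) :=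
  (IsSmooth.const _).mul (isSmooth_error ψ hα)

theorem isSmooth_linearHarmonic (hα : ContDiff ℝ (⊤ : ℕ∞) α) (i : Fin n) :
    IsSmooth (linearHarmonic conn hQ Y R ψ α lam h i) := by
  have hc := (isSmooth_gain ψ lam hα i).smul (Y i).smooth.comp_pos
  exact IsSmooth.mk hc
    ((isSmooth_bilinSpray conn hQ hc
      (fun x => Submodule.smul_mem _ _ ((Y i).tangent (pos x))) isSmooth_vel).add
      (((isSmooth_gain ψ lam hα i).smul ((isSmooth_covAt conn hQ (Y i) isSmooth_vel).add
        (isSmooth_bundleMap R (Y i).smooth.comp_pos))).neg.sub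
        (((isSmooth_gain ψ lam (contDiff_deriv_of_top hα) i).mul (isSmooth_errorRate ψ h)).smul
          (Y i).smooth.comp_pos))) (IsSmooth.const 0)

theorem isSmooth_quadraticHarmonic (hα : ContDiff ℝ (⊤ : ℕ∞) α) (p : Fin n × Fin n) :
    IsSmooth (quadraticHarmonic conn Y ψ α lam p) := by
  have hL : IsSmooth fun x : stateSpace Q => lieDeriv (Y p.2) ψ (pos x) :=
    ψ.smooth.dirDeriv_pos (Y p.2).smooth.comp_pos fun x => (Y p.2).tangent (pos x)
  exact IsSmooth.mk (IsSmooth.const 0)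
    ((((isSmooth_gain ψ lam hα p.1).mul (isSmooth_gain ψ lam hα p.2)).smul
      (conn.cov (Y p.2) (Y p.1)).smooth.comp_pos).neg.sub
      ((((isSmooth_gain ψ lam (contDiff_deriv_of_top hα) p.1).mul
        (isSmooth_gain ψ lam hα p.2)).mul hL).smul (Y p.1).smooth.comp_pos)) (IsSmooth.const 0)

theorem isSmooth_harmonics (hα : ContDiff ℝ (⊤ : ℕ∞) α) :
    ∀ k, IsSmooth (harmonics conn hQ Y₀ Y R ψ α lam mu h k)
  | Sum.inl _ => isSmooth_driftField conn hQ Y₀ Y R ψ lam mu h hα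
  | Sum.inr (Sum.inl i) => isSmooth_linearHarmonic conn hQ Y R ψ lam h hα i
  | Sum.inr (Sum.inr p) => isSmooth_quadraticHarmonic conn Y ψ lam hα p

theorem harmonics_mem_velocitySpan (x : stateSpace Q) :
    ∀ k, harmonics conn hQ Y₀ Y R ψ α lam mu h k x ∈ velocitySpan (stateSpace Q) (x : Ambient N)
  | Sum.inl _ => mk_bilinSpray_mem_velocitySpan conn hQ x _ (vel x).2
      (add_mem (sub_mem (Y₀.tangent _) (Subtype.prop _))
        (sum_mem fun i _ => Submodule.smul_mem _ _ ((Y i).tangent _)))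
  | Sum.inr (Sum.inl i) => mk_bilinSpray_mem_velocitySpan conn hQ x 0
      (Submodule.smul_mem _ _ ((Y i).tangent _))
      (sub_mem (neg_mem (Submodule.smul_mem _ _
        (add_mem (conn.covAt_mem hQ _ _ _) (Subtype.prop _))))
        (Submodule.smul_mem _ _ ((Y i).tangent _)))
  | Sum.inr (Sum.inr p) => mk_zero_mem_velocitySpan x 0
      (sub_mem (neg_mem (Submodule.smul_mem _ _ ((conn.cov (Y p.2) (Y p.1)).tangent _)))
        (Submodule.smul_mem _ _ ((Y p.1).tangent _)))

variable (α)

/-- Only the drift and the diagonal quadratic terms have nonzero mean; the factor one half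
disappears because the symmetric product of `Y i` with itself is twice its covariant derivative
along itself. -/
theorem averagedField_eq :
    (fun _ : ℝ => averagedField conn Y₀ Y R ψ α lam mu h) =
      modulatedField (fun k _ => coefficients 0 (fun p => if p.1 = p.2 then 1 else 0) k)
        (harmonics conn hQ Y₀ Y R ψ α lam mu h) := by
  funext _ x
  rw [modulatedField, sum_coefficients_smul_harmonics]
  simp only [Pi.zero_apply, zero_smul, Finset.sum_const_zero, zero_add, ite_smul, one_smul,
    Finset.sum_ite_eq, Finset.mem_univ, if_true]
  simp only [quadraticHarmonic, sum_mk, driftField, mk_add, averagedField, firstOrderField,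
    Finset.sum_const_zero, add_zero, conn.spray_eq hQ (pos x) (vel x).2]
  congr 1
  rw [add_assoc, add_right_inj, add_assoc, sub_sub, sub_eq_add_neg _ (_ + _), add_assoc,
    add_right_inj, ← sub_eq_add_neg]
  simp only [Finset.smul_sum, ← Finset.sum_add_distrib, ← Finset.sum_sub_distrib]
  refine Finset.sum_congr rfl fun i _ => ?_
  have e : conn.symProd (Y i) (Y i) (pos x) =
    conn.cov (Y i) (Y i) (pos x) + conn.cov (Y i) (Y i) (pos x) := rfl
  rw [e]
  module

variable (u : ℝ → Fin n → ℝ) (U : ℝ → Fin n → ℝ)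

/-- The rate of change of the velocity shift along the closed-loop system. -/
def ditherRate (ω t : ℝ) (x : stateSpace Q) : Euc N :=
  ∑ i, ((ω * u (ω * t) i) • (lam i * α (ψ (pos x) - filt x)) • Y i (pos x) +
    U (ω * t) i • ((lam i * deriv α (ψ (pos x) - filt x) * errorRate ψ h x) • Y i (pos x) +
      (lam i * α (ψ (pos x) - filt x)) • dirDeriv (Y i) (pos x) (vel x)))

/-- The closed-loop system in the new variables. -/
def transformedField (ω : ℝ) : ℝ → stateSpace Q → Ambient N :=
  modulatedField
    (fun k t => coefficients (U (ω * t)) (fun p => U (ω * t) p.1 * U (ω * t) p.2) k)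
    (harmonics conn hQ Y₀ Y R ψ α lam mu h)

theorem congr_mk {q q' v v' : Euc N} {η η' : ℝ} (hq : q = q') (hv : v = v') (hη : η = η') :
    mk q v η = mk q' v' η' := by
  rw [hq, hv, hη]

theorem coe_ditherShift (τ : ℝ) (q : Q) (η : ℝ) :
    (ditherShift Y ψ α U lam τ q η : Euc N) =
      ∑ i, U τ i • (lam i * α (ψ q - η)) • Y i q := by
  rw [ditherShift, Submodule.coe_sum]
  exact Finset.sum_congr rfl fun i _ => by simp only [Submodule.coe_smul, smul_smul, mul_assoc]

theorem eq_changeOfVariables_add (ω t : ℝ) (x : stateSpace Q) :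
    (x : Ambient N) = (changeOfVariables Y ψ α U lam ω t x : Ambient N) +
      mk 0 (ditherShift Y ψ α U lam (ω * t) (pos x) (filt x) : Euc N) 0 := by
  change mk (pos x : Euc N) (vel x) (filt x) =
    mk (pos x : Euc N) ((vel x : Euc N) +
      (-ditherShift Y ψ α U lam (ω * t) (pos x) (filt x) : tangentSpace Q (pos x : Euc N)))
      (filt x) + _
  rw [mk_add, add_zero, add_zero, Submodule.coe_neg, neg_add_cancel_right]

/-- The only discrepancy between the closed loop at `x` and the transformed field at the new point
is the rate of the shift, in the velocity slot. In the position slot the linear terms restore the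
old velocity from the new one. -/
theorem closedLoopField_eq (ω t : ℝ) (x : stateSpace Q) :
    closedLoopField conn Y₀ Y R ψ α u lam mu h ω t x =
      transformedField conn hQ Y₀ Y R ψ α lam mu h U ω t
        (changeOfVariables Y ψ α U lam ω t x) + mk 0 (ditherRate Y ψ α lam h u U ω t x) 0 := by
  set s := ditherShift Y ψ α U lam (ω * t) (pos x) (filt x) with hs
  set w : tangentSpace Q (pos x : Euc N) := vel x + -s with hw
  have hvw : vel x = w + s := (neg_add_cancel_right _ _).symm
  have hv : (vel x : Euc N) =
      w + ∑ i, U (ω * t) i • (lam i * α (ψ (pos x) - filt x)) • Y i (pos x) := by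
    rw [← coe_ditherShift, ← hs, ← Submodule.coe_add, ← hvw]
  have hR : (R.toFun (pos x) (vel x) : Euc N) = R.toFun (pos x) w +
      ∑ i, U (ω * t) i • (lam i * α (ψ (pos x) - filt x)) •
        (R.toFun (pos x) ⟨Y i (pos x), (Y i).tangent (pos x)⟩ : Euc N) := by
    rw [hvw, map_add, hs, ditherShift, map_sum, Submodule.coe_add, Submodule.coe_sum]
    simp only [map_smul, Submodule.coe_smul, smul_smul, mul_assoc]
  have key := spray_add_sum_eq (conn.bilinSpray hQ (pos x))
    (fun i => conn.covAt hQ (pos x) (Y i))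
    (fderivWithin ℝ (Function.extend Subtype.val ψ.toFun 0) Q (pos x)).toLinearMap
    (fun i => Y i (pos x)) (fun i => dirDeriv (Y i) (pos x) (vel x))
    (fun i => (R.toFun (pos x) ⟨Y i (pos x), (Y i).tangent (pos x)⟩ : Euc N))
    (U (ω * t)) (fun i => lam i * α (ψ (pos x) - filt x))
    (fun i => lam i * deriv α (ψ (pos x) - filt x))
    (fun i => ω * u (ω * t) i * lam i * α (ψ (pos x) - filt x))
    (fun i => mu i * lam i ^ 2 * α (ψ (pos x) - filt x) ^ 2)
    (-h * filt x + h * ψ (pos x)) (Y₀ (pos x)) hv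
    (fun i => conn.bilinSpray_vectorField hQ (pos x) (vel x).2 (Y i)) hR
  simp only [conn.covAt_vectorField] at key
  have hD : ditherRate Y ψ α lam h u U ω t x =
      ∑ i, ((ω * u (ω * t) i * lam i * α (ψ (pos x) - filt x)) • Y i (pos x) +
        U (ω * t) i • ((lam i * deriv α (ψ (pos x) - filt x) *
          (dirDeriv ψ (pos x) (vel x) - (-h * filt x + h * ψ (pos x)))) • Y i (pos x) +
          (lam i * α (ψ (pos x) - filt x)) • dirDeriv (Y i) (pos x) (vel x))) := by
    refine Finset.sum_congr rfl fun i _ => ?_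
    rw [smul_smul, ← mul_assoc]
    rfl
  rw [transformedField, modulatedField, sum_coefficients_smul_harmonics]
  simp only [driftField, linearHarmonic, quadraticHarmonic,
    smul_mk, sum_mk, mk_add, mul_zero, Finset.sum_const_zero, smul_zero, add_zero]
  rw [hD, closedLoopField, firstOrderField, conn.spray_eq hQ (pos x) (vel x).2]
  exact congr_mk hv key rfl

end Harmonics

/-! ## The zero-mean primitive of a dither signal -/

section Primitive

variable {n : ℕ} {u : ℝ → Fin n → ℝ} {T : ℝ}

theorem IsDither.intervalIntegrable (hu : IsDither u T) (i : Fin n) (a b : ℝ) :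
    IntervalIntegrable (fun τ => u τ i) volume a b := by
  obtain ⟨B, hB⟩ := hu.bounded
  refine (intervalIntegrable_const (c := B)).mono_fun
    ((measurable_pi_apply i).comp hu.measurable).aestronglyMeasurable (.of_forall fun τ => ?_)
  exact (hB τ i).trans (le_abs_self B)

theorem IsDither.zeroMeanPrimitive_eq_add (hu : IsDither u T) (i : Fin n) (a b : ℝ) :
    zeroMeanPrimitive u T b i = zeroMeanPrimitive u T a i + ∫ τ in a..b, u τ i := by
  rw [zeroMeanPrimitive, zeroMeanPrimitive, ← intervalIntegral.integral_add_adjacent_intervals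
    (hu.intervalIntegrable i 0 a) (hu.intervalIntegrable i a b)]
  ring

theorem IsDither.continuous_zeroMeanPrimitive (hu : IsDither u T) (i : Fin n) :
    Continuous fun τ => zeroMeanPrimitive u T τ i :=
  (intervalIntegral.continuous_primitive (hu.intervalIntegrable i) 0).sub continuous_const

theorem IsDither.periodic_zeroMeanPrimitive (hu : IsDither u T) (i : Fin n) :
    Function.Periodic (fun τ => zeroMeanPrimitive u T τ i) T := by
  intro τ
  have hp : Function.Periodic (fun τ => u τ i) T := fun s => congrFun (hu.periodic s) i
  change zeroMeanPrimitive u T (τ + T) i = zeroMeanPrimitive u T τ i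
  rw [hu.zeroMeanPrimitive_eq_add i τ (τ + T), hp.intervalIntegral_add_eq τ 0, zero_add,
    hu.zeroMean, add_zero]

theorem IsDither.integral_zeroMeanPrimitive (hu : IsDither u T) (i : Fin n) :
    ∫ τ in (0 : ℝ)..T, zeroMeanPrimitive u T τ i = 0 := by
  have hT : T ≠ 0 := hu.period_pos.ne'
  have hc := (intervalIntegral.continuous_primitive (hu.intervalIntegrable i) 0)
  simp only [zeroMeanPrimitive]
  rw [intervalIntegral.integral_sub (hc.intervalIntegrable 0 T) intervalIntegrable_const,
    intervalIntegral.integral_const, sub_zero, smul_eq_mul, ← mul_assoc, mul_one_div_cancel hT,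
    one_mul, sub_self]

theorem IsDither.integral_zeroMeanPrimitive_mul (hu : IsDither u T) (i j : Fin n) :
    ∫ τ in (0 : ℝ)..T, zeroMeanPrimitive u T τ i * zeroMeanPrimitive u T τ j =
      T * if i = j then 1 else 0 := by
  rw [← hu.orthonormal i j, ← mul_assoc, mul_one_div_cancel hu.period_pos.ne', one_mul]

end Primitive

/-! ## Conjugacy of the closed-loop system and the transformed system -/

section Conjugacy

/-- If `D` integrates along solutions to the increment of `S`, adding or subtracting it passes from
one integral equation to the other. The condition is required along solutions of either system, to
obtain both directions. -/
theorem isSolutionOn_conj_of_integral_eq {F : Type*} [NormedAddCommGroup F] [NormedSpace ℝ F]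
    {M : Set F} {f f' : ℝ → M → F} (φ : ℝ → M ≃ M) (D S : ℝ → M → F)
    (hf : ∀ t x, f t x = f' t (φ t x) + D t x) (hφ : ∀ t (x : M), (x : F) = (φ t x : F) + S t x)
    (h : ∀ (I : Set ℝ) (x : ℝ → M),
      (IsSolutionOn f I x ∨ IsSolutionOn f' I fun t => φ t (x t)) → ∀ s ∈ I, ∀ t ∈ I,
        IntervalIntegrable (fun τ => D τ (x τ)) volume s t ∧
          ∫ τ in s..t, D τ (x τ) = S t (x t) - S s (x s)) (I : Set ℝ) (x : ℝ → M) :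
    IsSolutionOn f I x ↔ IsSolutionOn f' I fun t => φ t (x t) := by
  constructor
  · intro hx
    refine ⟨hx.1, fun s hs t ht => ?_⟩
    obtain ⟨hD, hS⟩ := h I x (.inl hx) s hs t ht
    obtain ⟨hi, he⟩ := hx.2 s hs t ht
    have e : (fun τ => f' τ (φ τ (x τ))) = fun τ => f τ (x τ) - D τ (x τ) := by
      funext τ
      rw [hf, add_sub_cancel_right]
    rw [e, intervalIntegral.integral_sub hi hD, hS]
    refine ⟨hi.sub hD, ?_⟩
    rw [eq_sub_of_add_eq (hφ t (x t)).symm, eq_sub_of_add_eq (hφ s (x s)).symm, he]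
    abel
  · intro hx
    refine ⟨hx.1, fun s hs t ht => ?_⟩
    obtain ⟨hD, hS⟩ := h I x (.inr hx) s hs t ht
    obtain ⟨hi, he⟩ := hx.2 s hs t ht
    simp only [hf]
    rw [intervalIntegral.integral_add hi hD, hS]
    refine ⟨hi.add hD, ?_⟩
    rw [hφ t (x t), he, hφ s (x s)]
    abel

variable {N n : ℕ} {Q : Set (Euc N)} (conn : AffineConnection Q) (hQ : IsLocalSmoothRetract Q)
  (Y₀ : VectorField Q) (Y : Fin n → VectorField Q) (R : BundleMap Q) (ψ : SmoothFunction Q)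
  {α : ℝ → ℝ} (lam mu : Fin n → ℝ) (h : ℝ) {u U : ℝ → Fin n → ℝ}

theorem hasDerivWithinAt_gain_smul (hα : ContDiff ℝ (⊤ : ℕ∞) α) {I : Set ℝ} {x : ℝ → stateSpace Q}
    {t : ℝ} (hpos : HasDerivWithinAt (fun t => (pos (x t) : Euc N)) (vel (x t)) I t)
    (hfilt : HasDerivWithinAt (fun t => filt (x t)) (-h * filt (x t) + h * ψ (pos (x t))) I t)
    (i : Fin n) :
    HasDerivWithinAt
      (fun t => (lam i * α (ψ (pos (x t)) - filt (x t))) • Y i (pos (x t)))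
      ((lam i * deriv α (ψ (pos (x t)) - filt (x t)) * errorRate ψ h (x t)) • Y i (pos (x t)) +
        (lam i * α (ψ (pos (x t)) - filt (x t))) • dirDeriv (Y i) (pos (x t)) (vel (x t))) I t := by
  have h1 : HasDerivWithinAt (fun t => ψ (pos (x t)) - filt (x t)) (errorRate ψ h (x t)) I t :=
    (ψ.smooth.hasDerivWithinAt_comp hpos).sub hfilt
  have h2 := ((hα.differentiable (by simp)).differentiableAt
    (x := ψ (pos (x t)) - filt (x t))).hasDerivAt.comp_hasDerivWithinAt t h1
  have h3 := (h2.const_mul (lam i)).smul ((Y i).smooth.hasDerivWithinAt_comp hpos)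
  rw [add_comm, mul_assoc]
  exact h3

/-- The integral equations for `q` and `η` have continuous integrands, so `λ^i α Y_i` is
continuously differentiable along the curve and integration by parts against `U^i(ω ·)` applies. The
velocity itself is never differentiated. -/
theorem integral_ditherRate (hα : ContDiff ℝ (⊤ : ℕ∞) α)
    (hu : ∀ i a b, IntervalIntegrable (fun τ => u τ i) volume a b)
    (hU : ∀ i a b, U b i = U a i + ∫ τ in a..b, u τ i) (ω : ℝ) {I : Set ℝ} (hI : I.OrdConnected)
    {x : ℝ → stateSpace Q} (hx : ContinuousOn x I)
    (hpos : ∀ s ∈ I, ∀ t ∈ I,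
      (pos (x t) : Euc N) = pos (x s) + ∫ τ in s..t, (vel (x τ) : Euc N))
    (hfilt : ∀ s ∈ I, ∀ t ∈ I, filt (x t) =
      filt (x s) + ∫ τ in s..t, (-h * filt (x τ) + h * ψ (pos (x τ)))) :
    ∀ s ∈ I, ∀ t ∈ I,
      IntervalIntegrable (fun τ => ditherRate Y ψ α lam h u U ω τ (x τ)) volume s t ∧
        ∫ τ in s..t, ditherRate Y ψ α lam h u U ω τ (x τ) =
          (ditherShift Y ψ α U lam (ω * t) (pos (x t)) (filt (x t)) : Euc N) -
            (ditherShift Y ψ α U lam (ω * s) (pos (x s)) (filt (x s)) : Euc N) := by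
  intro s hs t ht
  have hst : uIcc s t ⊆ I := hI.uIcc_subset hs ht
  have hc : ∀ i, ∀ τ ∈ uIcc s t, HasDerivWithinAt
      (fun t => (lam i * α (ψ (pos (x t)) - filt (x t))) • Y i (pos (x t)))
      ((lam i * deriv α (ψ (pos (x τ)) - filt (x τ)) * errorRate ψ h (x τ)) • Y i (pos (x τ)) +
        (lam i * α (ψ (pos (x τ)) - filt (x τ))) • dirDeriv (Y i) (pos (x τ)) (vel (x τ)))
      (uIcc s t) τ := fun i τ hτ =>
    (hasDerivWithinAt_gain_smul Y ψ lam h hα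
      (hasDerivWithinAt_of_eq_add_integral hI (isSmooth_vel.continuous.comp_continuousOn hx) hpos
        (hst hτ))
      (hasDerivWithinAt_of_eq_add_integral hI
        ((isSmooth_filtRate ψ h).continuous.comp_continuousOn hx) hfilt (hst hτ)) i).mono hst
  have hc' : ∀ i, ContinuousOn (fun τ =>
      (lam i * deriv α (ψ (pos (x τ)) - filt (x τ)) * errorRate ψ h (x τ)) • Y i (pos (x τ)) +
        (lam i * α (ψ (pos (x τ)) - filt (x τ))) • dirDeriv (Y i) (pos (x τ)) (vel (x τ)))
      (uIcc s t) := fun i => by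
    have h1 : IsSmooth fun x : stateSpace Q =>
        (lam i * deriv α (ψ (pos x) - filt x) * errorRate ψ h x) • Y i (pos x) +
          (lam i * α (ψ (pos x) - filt x)) • dirDeriv (Y i) (pos x) (vel x) :=
      (((isSmooth_gain ψ lam (contDiff_deriv_of_top hα) i).mul (isSmooth_errorRate ψ h)).smul
        (Y i).smooth.comp_pos).add ((isSmooth_gain ψ lam hα i).smul
          ((Y i).smooth.dirDeriv_pos isSmooth_vel fun x => (vel x).2))
    exact h1.continuous.comp_continuousOn (hx.mono hst)
  have hg : ∀ i, IntervalIntegrable (fun τ => ω * u (ω * τ) i) volume s t := fun i => by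
    rcases eq_or_ne ω 0 with rfl | hω
    · simp
    · have := ((hu i (ω * s) (ω * t)).comp_mul_left (c := ω)).const_mul ω
      rwa [mul_div_cancel_left₀ _ hω, mul_div_cancel_left₀ _ hω] at this
  have hG : ∀ i, ∀ τ ∈ uIcc s t, U (ω * τ) i = U (ω * s) i + ∫ r in s..τ, ω * u (ω * r) i := by
    intro i τ _
    rw [intervalIntegral.integral_const_mul,
      intervalIntegral.mul_integral_comp_mul_left (f := fun r => u r i)]
    exact hU i _ _
  have key := fun i => integral_smul_add_smul_eq_sub (hg i) (hG i) (hc i) (hc' i)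
  simp only [ditherRate, coe_ditherShift]
  have hsum := IntervalIntegrable.sum Finset.univ fun i _ => (key i).1
  rw [Finset.sum_fn] at hsum
  refine ⟨hsum, ?_⟩
  rw [intervalIntegral.integral_finsetSum fun i _ => (key i).1, ← Finset.sum_sub_distrib]
  exact Finset.sum_congr rfl fun i _ => (key i).2

/-- The shift rate has no position component, so this is read off from `closedLoopField_eq`; the
transformed field does not contain `u`, which may therefore be taken to be `0` there. -/
theorem posL_transformedField (ω t : ℝ) (x : stateSpace Q) :
    posL N (transformedField conn hQ Y₀ Y R ψ α lam mu h U ω t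
      (changeOfVariables Y ψ α U lam ω t x)) = vel x := by
  have h1 := congrArg (posL N) (closedLoopField_eq conn hQ Y₀ Y R ψ α lam mu h 0 U ω t x)
  rw [map_add, posL_mk, add_zero] at h1
  exact h1.symm

theorem filtL_transformedField (ω t : ℝ) (x : stateSpace Q) :
    filtL N (transformedField conn hQ Y₀ Y R ψ α lam mu h U ω t
      (changeOfVariables Y ψ α U lam ω t x)) = -h * filt x + h * ψ (pos x) := by
  have h1 := congrArg (filtL N) (closedLoopField_eq conn hQ Y₀ Y R ψ α lam mu h 0 U ω t x)
  rw [map_add, filtL_mk, add_zero] at h1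
  exact h1.symm

theorem continuousOn_of_continuousOn_changeOfVariables (hα : ContDiff ℝ (⊤ : ℕ∞) α)
    (hU : ∀ i, Continuous fun τ => U τ i) (ω : ℝ) {I : Set ℝ} {x : ℝ → stateSpace Q}
    (hx : ContinuousOn (fun t => changeOfVariables Y ψ α U lam ω t (x t)) I) :
    ContinuousOn x I := by
  set y := fun t => changeOfVariables Y ψ α U lam ω t (x t)
  rw [Topology.IsInducing.subtypeVal.continuousOn_iff]
  have h1 : ∀ t, (x t : Ambient N) = (y t : Ambient N) + mkL N (0,
      ∑ i, U (ω * t) i • (lam i * α (ψ (pos (y t)) - filt (y t))) • Y i (pos (y t)), 0) := fun t => by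
    rw [eq_changeOfVariables_add Y ψ α lam U ω t (x t), coe_ditherShift]
    rfl
  have h2 : ContinuousOn (fun t => (y t : Ambient N) + mkL N (0,
      ∑ i, U (ω * t) i • (lam i * α (ψ (pos (y t)) - filt (y t))) • Y i (pos (y t)), 0)) I := by
    refine (continuous_subtype_val.comp_continuousOn hx).add
      ((mkL N).continuous.comp_continuousOn (continuousOn_const.prodMk
        ((continuousOn_finsetSum _ fun i _ => ?_).prodMk continuousOn_const)))
    exact ((hU i).comp (continuous_const.mul continuous_id)).continuousOn.smul
      (((isSmooth_gain ψ lam hα i).smul (Y i).smooth.comp_pos).continuous.comp_continuousOn hx)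
  exact h2.congr fun t _ => h1 t

theorem isSolutionOn_closedLoopField_iff (hα : ContDiff ℝ (⊤ : ℕ∞) α)
    (hu : ∀ i a b, IntervalIntegrable (fun τ => u τ i) volume a b)
    (hU : ∀ i a b, U b i = U a i + ∫ τ in a..b, u τ i) (hUc : ∀ i, Continuous fun τ => U τ i)
    (ω : ℝ) (I : Set ℝ) (x : ℝ → stateSpace Q) :
    IsSolutionOn (closedLoopField conn Y₀ Y R ψ α u lam mu h ω) I x ↔
      IsSolutionOn (transformedField conn hQ Y₀ Y R ψ α lam mu h U ω) I
        fun t => changeOfVariables Y ψ α U lam ω t (x t) := by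
  refine isSolutionOn_conj_of_integral_eq (changeOfVariables Y ψ α U lam ω)
    (fun t x => mkL N (0, ditherRate Y ψ α lam h u U ω t x, 0))
    (fun t x => mkL N (0, (ditherShift Y ψ α U lam (ω * t) (pos x) (filt x) : Euc N), 0))
    (closedLoopField_eq conn hQ Y₀ Y R ψ α lam mu h u U ω)
    (eq_changeOfVariables_add Y ψ α lam U ω) (fun I x hx => ?_) I x
  have hI : I.OrdConnected := hx.elim And.left And.left
  have hxc : ContinuousOn x I := hx.elim (fun h => h.continuousOn) fun h =>
    continuousOn_of_continuousOn_changeOfVariables Y ψ lam hα hUc ω h.continuousOn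
  -- For a component unaffected by the change of variables and with the same rate in both systems,
  -- the integral equation is the same whichever system is being solved. This is applied to position
  -- and filter state.
  have hint : ∀ {B : Type} [NormedAddCommGroup B] [NormedSpace ℝ B] [CompleteSpace B]
      (L : Ambient N →L[ℝ] B) (f : stateSpace Q → B),
      (∀ t (x : stateSpace Q), L (changeOfVariables Y ψ α U lam ω t x : Ambient N) = L x) →
      (∀ t x, L (closedLoopField conn Y₀ Y R ψ α u lam mu h ω t x) = f x) →
      (∀ t x, L (transformedField conn hQ Y₀ Y R ψ α lam mu h U ω t
        (changeOfVariables Y ψ α U lam ω t x)) = f x) →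
      ∀ s ∈ I, ∀ t ∈ I, L (x t) = L (x s) + ∫ τ in s..t, f (x τ) := by
    intro B _ _ _ L f h0 h1 h2 s hs t ht
    rcases hx with hx | hx
    · obtain ⟨hi, he⟩ := hx.2 s hs t ht
      have := L.intervalIntegral_comp_comm hi
      simp only [h1] at this
      rw [he, map_add, this]
    · obtain ⟨hi, he⟩ := hx.2 s hs t ht
      have := L.intervalIntegral_comp_comm hi
      simp only [h2] at this
      rw [← h0 t, he, map_add, this, h0]
  have key := integral_ditherRate Y ψ lam h hα hu hU ω hI hxc
    (hint (posL N) (fun x => (vel x : Euc N)) (fun _ _ => rfl) (fun _ _ => rfl)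
      (posL_transformedField conn hQ Y₀ Y R ψ lam mu h ω))
    (hint (filtL N) (fun x => -h * filt x + h * ψ (pos x)) (fun _ _ => rfl) (fun _ _ => rfl)
      (filtL_transformedField conn hQ Y₀ Y R ψ lam mu h ω))
  intro s hs t ht
  obtain ⟨hD, hS⟩ := key s hs t ht
  set J : Euc N →L[ℝ] Ambient N :=
    (mkL N).comp ((0 : Euc N →L[ℝ] Euc N).prod ((ContinuousLinearMap.id ℝ (Euc N)).prod 0))
  have h1 := J.intervalIntegral_comp_comm hD
  rw [hS, map_sub] at h1
  exact ⟨⟨J.integrable_comp hD.1, J.integrable_comp hD.2⟩, h1⟩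

end Conjugacy

/-! ## The main theorem -/

section Main

variable {n : ℕ}

theorem continuous_coefficients {U : ℝ → Fin n → ℝ} (hU : ∀ i, Continuous fun τ => U τ i) :
    ∀ k, Continuous fun τ => coefficients (U τ) (fun p => U τ p.1 * U τ p.2) k
  | Sum.inl _ => continuous_const
  | Sum.inr (Sum.inl i) => hU i
  | Sum.inr (Sum.inr p) => (hU p.1).mul (hU p.2)

theorem periodic_coefficients {U : ℝ → Fin n → ℝ} {T : ℝ}
    (hU : ∀ i, Function.Periodic (fun τ => U τ i) T) :
    ∀ k, Function.Periodic (fun τ => coefficients (U τ) (fun p => U τ p.1 * U τ p.2) k) T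
  | Sum.inl _ => fun _ => rfl
  | Sum.inr (Sum.inl i) => hU i
  | Sum.inr (Sum.inr p) => (hU p.1).mul (hU p.2)

theorem IsDither.integral_coefficients {u : ℝ → Fin n → ℝ} {T : ℝ} (hu : IsDither u T) :
    ∀ k, ∫ τ in (0 : ℝ)..T, coefficients (zeroMeanPrimitive u T τ)
        (fun p => zeroMeanPrimitive u T τ p.1 * zeroMeanPrimitive u T τ p.2) k =
      T * coefficients 0 (fun p => if p.1 = p.2 then 1 else 0) k
  | Sum.inl _ => by simp [coefficients]
  | Sum.inr (Sum.inl i) => by simpa [coefficients] using hu.integral_zeroMeanPrimitive i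
  | Sum.inr (Sum.inr p) => hu.integral_zeroMeanPrimitive_mul p.1 p.2

end Main

end ESC

end

open ESC in
theorem mainTheorem1 {N n : ℕ} (Q : Set (Euc N)) (hQ : IsEmbeddedSubmanifold Q)
    (conn : AffineConnection Q) (Y₀ : VectorField Q) (Y : Fin n → VectorField Q)
    (R : BundleMap Q) (ψ : SmoothFunction Q)
    (α : ℝ → ℝ) (hα : ContDiff ℝ (⊤ : ℕ∞) α) (hα_pos : ∀ z, 0 < α z * deriv α z)
    (hα_mono : StrictMono fun z => α z * deriv α z)
    (u : ℝ → Fin n → ℝ) (T : ℝ) (hu : IsDither u T)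
    (lam mu : Fin n → ℝ) (h : ℝ) (hh : 0 < h) :
    (∀ ω > 0, HasUniqueMaximalSolutions (closedLoopField conn Y₀ Y R ψ α u lam mu h ω)) ∧
    HasUniqueMaximalSolutions (fun _ : ℝ => averagedField conn Y₀ Y R ψ α lam mu h) ∧
    Approximates
      (closedLoopField conn Y₀ Y R ψ α u lam mu h)
      (changeOfVariables Y ψ α (zeroMeanPrimitive u T) lam)
      (fun _ => averagedField conn Y₀ Y R ψ α lam mu h) := by
  have hQr : IsLocalSmoothRetract Q := hQ.isLocalSmoothRetract
  have hUc := hu.continuous_zeroMeanPrimitive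
  have hX := isSmooth_harmonics conn hQr Y₀ Y R ψ lam mu h hα
  have hg := continuous_coefficients hUc
  have hconj := isSolutionOn_closedLoopField_iff conn hQr Y₀ Y R ψ lam mu h hα
    hu.intervalIntegrable hu.zeroMeanPrimitive_eq_add hUc
  refine ⟨fun ω _ => ?_, ?_, ?_⟩
  · exact (hasUniqueSolutions_conj _ (hconj ω) (hasUniqueSolutions_modulatedField
      (fun k => (hg k).comp (continuous_const.mul continuous_id))
      fun k => (hX k).locallyLipschitz)).hasUniqueMaximalSolutions
  · rw [averagedField_eq conn hQr]
    exact (hasUniqueSolutions_modulatedField (fun k => continuous_const)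
      fun k => (hX k).locallyLipschitz).hasUniqueMaximalSolutions
  · rw [averagedField_eq conn hQr]
    intro C hC ν hν Δ hΔ
    obtain ⟨ω₀, hω₀, H⟩ := exists_forall_norm_sub_le_of_averaging hQr.stateSpace hu.period_pos hg
      (periodic_coefficients hu.periodic_zeroMeanPrimitive) hu.integral_coefficients hX
      (fun k x => harmonics_mem_velocitySpan conn hQr Y₀ Y R ψ lam mu h x k) hC hν hΔ
    refine ⟨ω₀, hω₀, fun t₀ x₀ _ J xbar hxbar hJ ω hω I x hx => ?_⟩
    -- In the new variables the initial value is `x₀`, the starting point of `xbar`, so the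
    -- averaging theorem compares two solutions with a common initial state.
    have hx' := isMaximalSolution_conj _ (hconj ω) hx
    rw [Equiv.apply_symm_apply, ← hxbar.2.1] at hx'
    exact H t₀ J xbar hxbar.2.2.1 hJ ω hω I _ hx'
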